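/- Let $\mathsf B$ be an additive category with chosen finite products, let $\mathsf X$ be a category with chosen finite products, and let $P\colon\mathsf X\to\mathsf B$ be a cartesian monoidal opfibration: $P$ is a Grothendieck opfibration, $P$ strictly preserves the terminal object and binary products (with their projections), and the product of two $P$-cocartesian arrows is $P$-cocartesian. Choose for each $f\colon A\to A'$ in $\mathsf B$ and each $X$ in $\mathsf X$ with $P(X)=A$ a cocartesian lifting $\hat f\colon X\to f_*X$ of $f$, and let $F\colon\mathsf B\to\mathsf{CAT}$ be the associated pseudofunctor: $F(A)$ is the fibre of $P$ over $A$ and $F(f)=f_*$ is the change of base functor, with structure isomorphisms $F(gf)\cong F(g)F(f)$ and $F(1_A)\cong 1_{F(A)}$ induced by the universal property of cocartesian liftings. Suppose that for every $X$ in $\mathsf X$ the terminal map $\tau_X\colon X\to I_{\mathsf X}$ and the diagonal $\Delta_X\colon X\to X\times X$ are $P$-cocartesian. Then $F$ factors through symmetric 2-groups: there is a pseudofunctor $G\colon\mathsf B\to\mathsf{SCG}$ with $UG=F$. Here $\mathsf{SCG}$ is the 2-category of symmetric 2-groups (symmetric monoidal groupoids in which every object is weakly invertible for the tensor product), strong symmetric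 monoidal functors and monoidal natural transformations, and $U\colon\mathsf{SCG}\to\mathsf{CAT}$ is the forgetful 2-functor. Moreover $G$ can be chosen to carry the canonical structure, as follows. Let $m=\pi_1+\pi_2\colon A\times A\to A$ and $e=0\colon I_{\mathsf B}\to A$ be the internal abelian group structure of $A$. * On objects, the tensor product of $F(A)$ is $X\otimes Y=m_*(X\times Y)$ and its unit object is $E=e_*I_{\mathsf X}$. * The tensor product of arrows, the associator, the unitors and the braiding of $F(A)$ are induced, along the cocartesian liftings $X\times Y\to X\otimes Y$ and $I_{\mathsf X}\to E$, by those of the cartesian monoidal category $\mathsf X$. * For every $X$ in $F(A)$, the object $(-1_A)_*X$ is a weak inverse of $X$. * The symmetric monoidal structure $f_*X\otimes f_*Y\cong f_*(X\otimes Y)$, $E\cong f_*E$ of $F(f)$ is induced by $\hat f\times\hat f$ and by the identity of $I_{\mathsf X}$. -/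

import Mathlib

open CategoryTheory MonoidalCategory CartesianMonoidalCategory Bicategory

universe v v₁ v₂ u u₁ u₂ w₁ w₂ w₃

namespace TwoGroups

/-! ### Symmetric 2-groups -/

/-- A monoidal category is a 2-group if it is a groupoid in which every object is weakly
invertible with respect to the tensor product. -/
class IsTwoGroup (C : Type u) [Category.{v} C] [MonoidalCategory C] : Prop where
  isIso {x y : C} (f : x ⟶ y) : IsIso f
  exists_inverse (x : C) : ∃ y : C, Nonempty (x ⊗ y ≅ 𝟙_ C) ∧ Nonempty (y ⊗ x ≅ 𝟙_ C)

/-- The structure of a symmetric 2-group on a category. -/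
class SymmetricTwoGroup (C : Type u) [Category.{v} C] extends
    MonoidalCategory C, SymmetricCategory C, IsTwoGroup C

/-- Symmetric 2-groups: the objects of the 2-category `SCG`. -/
structure SCG : Type (max (u + 1) (v + 1)) where
  carrier : Type u
  [category : Category.{v} carrier]
  [str : SymmetricTwoGroup carrier]

namespace SCG

instance : CoeSort SCG.{v, u} (Type u) := ⟨SCG.carrier⟩

attribute [instance] SCG.category SCG.str

/-- A morphism of symmetric 2-groups is a (strong) symmetric monoidal functor. -/
structure Hom (C D : SCG.{v, u}) where
  toFunctor : C ⥤ D
  [braided : toFunctor.Braided]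

attribute [instance] Hom.braided

/-- A 2-cell between morphisms of symmetric 2-groups is a monoidal natural transformation. -/
@[ext]
structure Hom₂ {C D : SCG.{v, u}} (F G : Hom C D) where
  toNatTrans : F.toFunctor ⟶ G.toFunctor
  isMonoidal : NatTrans.IsMonoidal toNatTrans

attribute [instance] Hom₂.isMonoidal

instance : Quiver SCG.{v, u} where
  Hom C D := Hom C D

@[simps]
instance homCategory (C D : SCG.{v, u}) : Category (C ⟶ D) where
  Hom F G := Hom₂ F G
  id F := ⟨𝟙 F.toFunctor, inferInstance⟩
  comp α β := ⟨α.toNatTrans ≫ β.toNatTrans,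
    have := α.isMonoidal; have := β.isMonoidal; inferInstance⟩

@[ext]
theorem hom₂_ext {C D : SCG.{v, u}} {F G : C ⟶ D} {α β : F ⟶ G}
    (h : α.toNatTrans = β.toNatTrans) : α = β := Hom₂.ext h

/-- An invertible monoidal natural transformation is an invertible 2-cell. -/
@[simps]
def isoMk {C D : SCG.{v, u}} {F G : C ⟶ D} (e : F.toFunctor ≅ G.toFunctor)
    [he : NatTrans.IsMonoidal e.hom] : F ≅ G where
  hom := ⟨e.hom, he⟩
  inv := ⟨e.inv, inferInstance⟩
  hom_inv_id := by ext1; exact e.hom_inv_id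
  inv_hom_id := by ext1; exact e.inv_hom_id

/-- The 2-category of symmetric 2-groups, symmetric monoidal functors and monoidal natural
transformations. -/
instance bicategory : Bicategory SCG.{v, u} where
  id C := ⟨𝟭 C⟩
  comp F G := ⟨F.toFunctor ⋙ G.toFunctor⟩
  homCategory := homCategory
  whiskerLeft F _ _ η := ⟨Functor.whiskerLeft F.toFunctor η.toNatTrans, inferInstance⟩
  whiskerRight η H := ⟨Functor.whiskerRight η.toNatTrans H.toFunctor, inferInstance⟩
  associator F G H := isoMk (Functor.associator F.toFunctor G.toFunctor H.toFunctor)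
  leftUnitor F := isoMk (Functor.leftUnitor F.toFunctor)
  rightUnitor F := isoMk (Functor.rightUnitor F.toFunctor)

/-- The forgetful functor from symmetric 2-groups to categories. -/
def forget : SCG.{v, u} ⥤ᵖ Cat.{v, u} where
  obj C := Cat.of C
  map F := F.toFunctor.toCatHom
  map₂ η := η.toNatTrans.toCatHom₂
  mapId C := Iso.refl _
  mapComp F G := Iso.refl _
  map₂_whisker_left F _ _ η := ((Category.id_comp _).trans (Category.comp_id _)).symm
  map₂_whisker_right η F := ((Category.id_comp _).trans (Category.comp_id _)).symm
  map₂_associator F G H := by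
    ext x
    change 𝟙 _ = 𝟙 _ ≫ H.toFunctor.map (𝟙 _) ≫ 𝟙 _ ≫ 𝟙 _ ≫ 𝟙 _
    simp
  map₂_left_unitor {C D} F := by
    have key (x : C) : 𝟙 (F.toFunctor.obj x) =
        𝟙 (F.toFunctor.obj x) ≫ F.toFunctor.map (𝟙 x) ≫ 𝟙 (F.toFunctor.obj x) := by simp
    ext x
    exact key x
  map₂_right_unitor F := by
    ext x
    change 𝟙 _ = 𝟙 _ ≫ 𝟙 _ ≫ 𝟙 _
    simp

end SCG

/-! ### Factorizations through symmetric 2-groups -/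

/-- The data of a factorization of a pseudofunctor `F` to categories through symmetric 2-groups:
symmetric 2-group structures on the categories `F a`, symmetric monoidal structures on the functors
`F f`, such that all the structure cells of `F` are monoidal natural transformations. -/
structure SCGLift {K : Type w₁} [Bicategory.{w₂, w₃} K] (F : K ⥤ᵖ Cat.{v, u}) where
  obj (a : K) : SymmetricTwoGroup (F.obj a)
  map {a b : K} (f : a ⟶ b) : (F.map f).toFunctor.Braided
  map₂_isMonoidal {a b : K} {f g : a ⟶ b} (η : f ⟶ g) :
    NatTrans.IsMonoidal (F.map₂ η).toNatTrans
  mapId_isMonoidal (a : K) :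
    NatTrans.IsMonoidal (F₂ := 𝟭 (F.obj a)) (F.mapId a).hom.toNatTrans
  mapComp_isMonoidal {a b c : K} (f : a ⟶ b) (g : b ⟶ c) :
    NatTrans.IsMonoidal (F₂ := (F.map f).toFunctor ⋙ (F.map g).toFunctor)
      (F.mapComp f g).hom.toNatTrans

namespace SCGLift

variable {K : Type w₁} [Bicategory.{w₂, w₃} K] {F : K ⥤ᵖ Cat.{v, u}} (L : SCGLift F)

/-- The pseudofunctor to symmetric 2-groups given by a factorization. -/
def toPseudofunctor : K ⥤ᵖ SCG.{v, u} where
  obj a := letI := L.obj a; ⟨F.obj a⟩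
  map {a b} f := letI := L.obj a; letI := L.obj b; letI := L.map f; ⟨(F.map f).toFunctor⟩
  map₂ η := ⟨(F.map₂ η).toNatTrans, L.map₂_isMonoidal η⟩
  map₂_id f := by ext x; simp
  map₂_comp η θ := by ext x; simp
  mapId a := SCG.isoMk (Cat.Hom.toNatIso (F.mapId a)) (he := L.mapId_isMonoidal a)
  mapComp f g := SCG.isoMk (Cat.Hom.toNatIso (F.mapComp f g)) (he := L.mapComp_isMonoidal f g)
  map₂_whisker_left f _ _ η := by
    ext1; exact congrArg Cat.Hom₂.toNatTrans (F.map₂_whisker_left f η)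
  map₂_whisker_right η f := by
    ext1; exact congrArg Cat.Hom₂.toNatTrans (F.map₂_whisker_right η f)
  map₂_associator f g h := by
    ext1; exact congrArg Cat.Hom₂.toNatTrans (F.map₂_associator f g h)
  map₂_left_unitor f := by
    ext1; exact congrArg Cat.Hom₂.toNatTrans (F.map₂_left_unitor f)
  map₂_right_unitor f := by
    ext1; exact congrArg Cat.Hom₂.toNatTrans (F.map₂_right_unitor f)

/-- The pseudofunctor to symmetric 2-groups is a factorization of `F` on the nose. -/
theorem toPseudofunctor_comp_forget : L.toPseudofunctor.comp SCG.forget = F := by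
  have h₁ (a : K) : ((L.toPseudofunctor.comp SCG.forget).mapId a).hom = (F.mapId a).hom :=
    Category.comp_id (F.mapId a).hom
  have h₂ {a b c : K} (f : a ⟶ b) (g : b ⟶ c) :
      ((L.toPseudofunctor.comp SCG.forget).mapComp f g).hom = (F.mapComp f g).hom :=
    Category.comp_id (F.mapComp f g).hom
  have h₁' : @(L.toPseudofunctor.comp SCG.forget).mapId = @F.mapId :=
    funext fun a ↦ Iso.ext (h₁ a)
  have h₂' : @(L.toPseudofunctor.comp SCG.forget).mapComp = @F.mapComp := by
    funext a b c f g
    exact Iso.ext (h₂ f g)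
  have key (G : K ⥤ᵖ Cat.{v, u}) (hG : G.toPrelaxFunctor = F.toPrelaxFunctor)
      (hi : HEq @G.mapId @F.mapId) (hc : HEq @G.mapComp @F.mapComp) : G = F := by
    cases G; cases F
    dsimp only at hG
    subst hG
    cases hi; cases hc
    rfl
  exact key _ rfl (heq_of_eq h₁') (heq_of_eq h₂')

end SCGLift

/-! ### Opfibrations and the associated pseudofunctor -/

section Opfibrations

variable {X : Type u₁} [Category.{v₁} X] {B : Type u₂} [Category.{v₂} B]

/-- A morphism `φ` of `X` is `P`-cocartesian. -/
abbrev IsCocart (P : X ⥤ B) {x y : X} (φ : x ⟶ y) : Prop :=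
  P.IsStronglyCocartesian (P.map φ) φ

/-- The inclusion of a fibre of `P` into the total category. -/
abbrev incl {P : X ⥤ B} {A : B} : P.Fiber A ⥤ X := Functor.Fiber.fiberInclusion

/-- A choice of cocartesian liftings. -/
structure Opcleavage (P : X ⥤ B) where
  /-- `push f x` is `f_* x`, for `x` in the fibre over the domain of `f`. -/
  push {A A' : B} (f : A ⟶ A') (x : P.Fiber A) : P.Fiber A'
  /-- The chosen cocartesian lifting of `f` at `x`. -/
  lift {A A' : B} (f : A ⟶ A') (x : P.Fiber A) : incl.obj x ⟶ incl.obj (push f x)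
  isStronglyCocartesian {A A' : B} (f : A ⟶ A') (x : P.Fiber A) :
    P.IsStronglyCocartesian f (lift f x)

namespace Opcleavage

variable {P : X ⥤ B} (c : Opcleavage P)

attribute [instance] Opcleavage.isStronglyCocartesian

theorem fiber_hom_ext {A A' : B} {f : A ⟶ A'} {a : X} {x y : P.Fiber A'} (l : a ⟶ incl.obj x)
    [P.IsStronglyCocartesian f l] {φ ψ : x ⟶ y} (h : l ≫ incl.map φ = l ≫ incl.map ψ) : φ = ψ :=
  Functor.Fiber.hom_ext (Functor.IsCocartesian.ext P f l (incl.map φ) (incl.map ψ) h)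

instance {A : B} {x y : P.Fiber A} (φ : x ⟶ y) : P.IsHomLift (𝟙 A) (incl.map φ) := φ.2

/-- The vertical morphism induced by a cocartesian morphism `l` over `f` and a morphism `k` over
`f` with the same domain. -/
noncomputable def desc {A A' : B} (f : A ⟶ A') {a : X} {x y : P.Fiber A'} (l : a ⟶ incl.obj x)
    (k : a ⟶ incl.obj y) (hl : P.IsStronglyCocartesian f l) (hk : P.IsHomLift f k) : x ⟶ y :=
  let m : incl.obj x ⟶ incl.obj y := Functor.IsCocartesian.map P f l k
  ⟨m, Functor.IsCocartesian.map_isHomLift P f l k⟩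

@[simp]
theorem fac {A A' : B} (f : A ⟶ A') {a : X} {x y : P.Fiber A'} (l : a ⟶ incl.obj x)
    (k : a ⟶ incl.obj y) (hl : P.IsStronglyCocartesian f l) (hk : P.IsHomLift f k) :
    l ≫ incl.map (desc f l k hl hk) = k :=
  Functor.IsCocartesian.fac P f l k

@[simp]
theorem fac_assoc {A A' : B} (f : A ⟶ A') {a : X} {x y : P.Fiber A'} (l : a ⟶ incl.obj x)
    (k : a ⟶ incl.obj y) (hl : P.IsStronglyCocartesian f l) (hk : P.IsHomLift f k) {z : X}
    (m : incl.obj y ⟶ z) : l ≫ incl.map (desc f l k hl hk) ≫ m = k ≫ m := by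
  rw [← Category.assoc, fac]

/-- The vertical isomorphism between the codomains of two cocartesian morphisms over `f`. -/
noncomputable def vertIso {A A' : B} (f : A ⟶ A') {a : X} {x y : P.Fiber A'} (l : a ⟶ incl.obj x)
    (k : a ⟶ incl.obj y) (hl : P.IsStronglyCocartesian f l) (hk : P.IsStronglyCocartesian f k) :
    x ≅ y where
  hom := desc f l k hl inferInstance
  inv := desc f k l hk inferInstance
  hom_inv_id := fiber_hom_ext (f := f) l (by simp)
  inv_hom_id := fiber_hom_ext (f := f) k (by simp)

theorem comp_vertIso_hom {A A' : B} (f : A ⟶ A') {a : X} {x y : P.Fiber A'} (l : a ⟶ incl.obj x)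
    (k : a ⟶ incl.obj y) (hl : P.IsStronglyCocartesian f l) (hk : P.IsStronglyCocartesian f k) :
    l ≫ incl.map (vertIso f l k hl hk).hom = k := fac _ _ _ hl _

theorem comp_vertIso_inv {A A' : B} (f : A ⟶ A') {a : X} {x y : P.Fiber A'} (l : a ⟶ incl.obj x)
    (k : a ⟶ incl.obj y) (hl : P.IsStronglyCocartesian f l) (hk : P.IsStronglyCocartesian f k) :
    k ≫ incl.map (vertIso f l k hl hk).inv = l := fac _ _ _ hk _

/-- The action of the change of base functor `f_*` on morphisms. -/
noncomputable def pushMap {A A' : B} (f : A ⟶ A') {x y : P.Fiber A} (φ : x ⟶ y) :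
    c.push f x ⟶ c.push f y :=
  desc f (c.lift f x) (incl.map φ ≫ c.lift f y) inferInstance inferInstance

@[simp]
theorem lift_pushMap {A A' : B} (f : A ⟶ A') {x y : P.Fiber A} (φ : x ⟶ y) :
    c.lift f x ≫ incl.map (c.pushMap f φ) = incl.map φ ≫ c.lift f y :=
  fac _ _ _ _ _

@[simp]
theorem lift_pushMap_assoc {A A' : B} (f : A ⟶ A') {x y : P.Fiber A} (φ : x ⟶ y) {z : X}
    (k : incl.obj (c.push f y) ⟶ z) :
    c.lift f x ≫ incl.map (c.pushMap f φ) ≫ k = incl.map φ ≫ c.lift f y ≫ k := by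
  rw [← Category.assoc, lift_pushMap, Category.assoc]

/-- The change of base functor `f_*`. -/
noncomputable def pushFunctor {A A' : B} (f : A ⟶ A') : P.Fiber A ⥤ P.Fiber A' where
  obj x := c.push f x
  map φ := c.pushMap f φ
  map_id x := fiber_hom_ext (f := f) (c.lift f x) (by simp)
  map_comp {x y z} φ ψ := fiber_hom_ext (f := f) (c.lift f x) (by simp)

/-- The comparison `(𝟙 A)_* x ≅ x`, induced by the cocartesian lifting `𝟙 x` of `𝟙 A`. -/
noncomputable def pushIdIso {A : B} (x : P.Fiber A) : c.push (𝟙 A) x ≅ x :=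
  vertIso (𝟙 A) (c.lift (𝟙 A) x) (𝟙 (incl.obj x)) inferInstance
    (have : P.IsHomLift (𝟙 A) (𝟙 (incl.obj x)) := IsHomLift.id x.2; inferInstance)

@[simp]
theorem lift_pushIdIso {A : B} (x : P.Fiber A) :
    c.lift (𝟙 A) x ≫ incl.map (c.pushIdIso x).hom = 𝟙 (incl.obj x) :=
  comp_vertIso_hom _ _ _ _ _

@[simp]
theorem lift_pushIdIso_assoc {A : B} (x : P.Fiber A) {z : X} (k : incl.obj x ⟶ z) :
    c.lift (𝟙 A) x ≫ incl.map (c.pushIdIso x).hom ≫ k = k := by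
  rw [← Category.assoc, lift_pushIdIso, Category.id_comp]

/-- The comparison `(f ≫ g)_* x ≅ g_* f_* x`, induced by the composite of cocartesian liftings. -/
noncomputable def pushCompIso {A A' A'' : B} (f : A ⟶ A') (g : A' ⟶ A'') (x : P.Fiber A) :
    c.push (f ≫ g) x ≅ c.push g (c.push f x) :=
  vertIso (f ≫ g) (c.lift (f ≫ g) x) (c.lift f x ≫ c.lift g (c.push f x))
    inferInstance inferInstance

@[simp]
theorem lift_pushCompIso {A A' A'' : B} (f : A ⟶ A') (g : A' ⟶ A'') (x : P.Fiber A) :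
    c.lift (f ≫ g) x ≫ incl.map (c.pushCompIso f g x).hom =
      c.lift f x ≫ c.lift g (c.push f x) :=
  comp_vertIso_hom _ _ _ _ _

@[simp]
theorem lift_pushCompIso_assoc {A A' A'' : B} (f : A ⟶ A') (g : A' ⟶ A'') (x : P.Fiber A) {z : X}
    (k : incl.obj (c.push g (c.push f x)) ⟶ z) :
    c.lift (f ≫ g) x ≫ incl.map (c.pushCompIso f g x).hom ≫ k =
      c.lift f x ≫ c.lift g (c.push f x) ≫ k := by
  rw [← Category.assoc, lift_pushCompIso, Category.assoc]

@[simp]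
theorem lift_pushCompIso_inv {A A' A'' : B} (f : A ⟶ A') (g : A' ⟶ A'') (x : P.Fiber A) :
    c.lift f x ≫ c.lift g (c.push f x) ≫ incl.map (c.pushCompIso f g x).inv =
      c.lift (f ≫ g) x := by
  rw [← Category.assoc]
  exact comp_vertIso_inv _ _ _ _ _

@[simp]
theorem lift_pushCompIso_inv_assoc {A A' A'' : B} (f : A ⟶ A') (g : A' ⟶ A'') (x : P.Fiber A)
    {z : X} (k : incl.obj (c.push (f ≫ g) x) ⟶ z) :
    c.lift f x ≫ c.lift g (c.push f x) ≫ incl.map (c.pushCompIso f g x).inv ≫ k =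
      c.lift (f ≫ g) x ≫ k := by
  rw [← lift_pushCompIso_inv, Category.assoc, Category.assoc]

theorem lift_eqToHom {A A' : B} {f g : A ⟶ A'} (h : f = g) (x : P.Fiber A)
    (h' : c.push f x = c.push g x) :
    c.lift f x ≫ incl.map (eqToHom h') = c.lift g x := by
  subst h; simp

/-- The natural isomorphism `(𝟙 A)_* ≅ 𝟭`. -/
noncomputable def pushId (A : B) : c.pushFunctor (𝟙 A) ≅ 𝟭 (P.Fiber A) :=
  NatIso.ofComponents c.pushIdIso (fun {x y} φ ↦
    (fiber_hom_ext (f := 𝟙 A) (c.lift (𝟙 A) x) (by simp) :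
      c.pushMap (𝟙 A) φ ≫ (c.pushIdIso y).hom = (c.pushIdIso x).hom ≫ φ))

/-- The natural isomorphism `(f ≫ g)_* ≅ g_* f_*`. -/
noncomputable def pushComp {A A' A'' : B} (f : A ⟶ A') (g : A' ⟶ A'') :
    c.pushFunctor (f ≫ g) ≅ c.pushFunctor f ⋙ c.pushFunctor g :=
  NatIso.ofComponents (c.pushCompIso f g) (fun {x y} φ ↦
    (fiber_hom_ext (f := f ≫ g) (c.lift (f ≫ g) x) (by simp) :
      c.pushMap (f ≫ g) φ ≫ (c.pushCompIso f g y).hom =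
        (c.pushCompIso f g x).hom ≫ c.pushMap g (c.pushMap f φ)))

theorem eqToHom_pushFunctor_app {A A' : B} {f g : A ⟶ A'} (h : f = g) (x : P.Fiber A)
    (h₁ : (c.pushFunctor f).toCatHom = (c.pushFunctor g).toCatHom) (h₂ : c.push f x = c.push g x) :
    eqToHom h₂ = (eqToHom h₁).toNatTrans.app x := by
  subst h; rfl

/-- The pseudofunctor associated with a cloven opfibration: it sends an object to its fibre and an
arrow to the change of base functor. -/
noncomputable def pseudofunctor : LocallyDiscrete B ⥤ᵖ Cat.{v₁, u₁} :=
  LocallyDiscrete.mkPseudofunctor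
    (fun A ↦ Cat.of (P.Fiber A))
    (fun f ↦ (c.pushFunctor f).toCatHom)
    (fun A ↦ Cat.Hom.isoMk (c.pushId A))
    (fun f g ↦ Cat.Hom.isoMk (c.pushComp f g))
    (fun {A₀ _ _ A₃} f g h ↦ by
      ext x
      have h' (x : P.Fiber A₀) : c.push ((f ≫ g) ≫ h) x = c.push (f ≫ g ≫ h) x := by rw [Category.assoc]
      have key (x : P.Fiber A₀) := (fiber_hom_ext (f := (f ≫ g) ≫ h) (c.lift _ x)
        (by simp [lift_eqToHom]) :
        (c.pushCompIso (f ≫ g) h x).hom ≫ c.pushMap h (c.pushCompIso f g x).hom ≫ 𝟙 _ ≫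
          (c.pushCompIso g h (c.push f x)).inv ≫ (c.pushCompIso f (g ≫ h) x).inv = eqToHom (h' x))
      exact (key x).trans (c.eqToHom_pushFunctor_app (by simp) x _ (h' x)))
    (fun {A₀ A₁} f ↦ by
      ext x
      have h' (x : P.Fiber A₀) : c.push (𝟙 A₀ ≫ f) x = c.push f x := by rw [Category.id_comp]
      have key (x : P.Fiber A₀) := (fiber_hom_ext (f := 𝟙 A₀ ≫ f) (c.lift _ x)
        (by simp [lift_eqToHom]) :
        (c.pushCompIso (𝟙 A₀) f x).hom ≫ c.pushMap f (c.pushIdIso x).hom ≫ 𝟙 _ = eqToHom (h' x))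
      exact (key x).trans (c.eqToHom_pushFunctor_app (by simp) x _ (h' x)))
    (fun {A₀ A₁} f ↦ by
      ext x
      have h' (x : P.Fiber A₀) : c.push (f ≫ 𝟙 A₁) x = c.push f x := by rw [Category.comp_id]
      have key (x : P.Fiber A₀) := (fiber_hom_ext (f := f ≫ 𝟙 A₁) (c.lift _ x)
        (by simp [lift_eqToHom]) :
        (c.pushCompIso f (𝟙 A₁) x).hom ≫ (c.pushIdIso (c.push f x)).hom ≫ 𝟙 _ = eqToHom (h' x))
      exact (key x).trans (c.eqToHom_pushFunctor_app (by simp) x _ (h' x)))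

end Opcleavage

/-! ### Cartesian monoidal opfibrations -/

section Cartesian

variable [CartesianMonoidalCategory X] [CartesianMonoidalCategory B]

/-- `P` is a cartesian monoidal opfibration: it is an opfibration between categories with finite
products, it preserves finite products strictly (the terminal object is sent to the terminal
object, and the projections of `x ⊗ y` lie over the projections of `P x ⊗ P y`; in particular
`P (x ⊗ y) = P x ⊗ P y`), and products of cocartesian morphisms are cocartesian. -/
structure IsCartesianMonoidalOpfibration (P : X ⥤ B) : Prop where
  exists_lift {A A' : B} (f : A ⟶ A') (x : P.Fiber A) :
    ∃ (y : P.Fiber A') (l : incl.obj x ⟶ incl.obj y), P.IsStronglyCocartesian f l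
  obj_unit : P.obj (𝟙_ X) = 𝟙_ B
  fst_isHomLift (x y : X) : P.IsHomLift (fst (P.obj x) (P.obj y)) (fst x y)
  snd_isHomLift (x y : X) : P.IsHomLift (snd (P.obj x) (P.obj y)) (snd x y)
  tensor_isCocart {x y x' y' : X} (φ : x ⟶ x') (ψ : y ⟶ y') :
    IsCocart P φ → IsCocart P ψ → IsCocart P (φ ⊗ₘ ψ)

namespace IsCartesianMonoidalOpfibration

variable {P : X ⥤ B} (hP : IsCartesianMonoidalOpfibration P)

theorem obj_tensor (hP : IsCartesianMonoidalOpfibration P) (x y : X) : P.obj (x ⊗ y) = P.obj x ⊗ P.obj y :=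
  have := hP.fst_isHomLift x y
  IsHomLift.domain_eq P (fst (P.obj x) (P.obj y)) (fst x y)

/-- The product of `x` over `A` and `y` over `A'`, as an object over `A ⊗ A'`. -/
def prod {A A' : B} (x : P.Fiber A) (y : P.Fiber A') : P.Fiber (A ⊗ A') :=
  ⟨incl.obj x ⊗ incl.obj y, by
    rw [hP.obj_tensor]
    exact congrArg₂ (· ⊗ ·) x.2 y.2⟩

/-- The terminal object of `X`, as an object over the terminal object of `B`. -/
def unit : P.Fiber (𝟙_ B) := ⟨𝟙_ X, hP.obj_unit⟩

end IsCartesianMonoidalOpfibration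

/-! ### The canonical symmetric monoidal structure on the fibres over an additive category -/

section Additive

variable [Preadditive B]

/-- The addition of the internal abelian group `A`. -/
def addHom (A : B) : A ⊗ A ⟶ A := fst A A + snd A A

/-- The neutral element of the internal abelian group `A`. -/
def zeroHom (A : B) : 𝟙_ B ⟶ A := 0

variable {P : X ⥤ B} (hP : IsCartesianMonoidalOpfibration P) (c : Opcleavage P)

/-- The tensor product `m_* (x × y)` of two objects `x`, `y` of the fibre over `A`, where `m` is
the addition of `A`. -/
def tensorPush {A : B} (x y : P.Fiber A) : P.Fiber A :=
  c.push (addHom A) (hP.prod x y)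

/-- The cocartesian lifting `x × y ⟶ m_* (x × y)`. -/
def tensorPushLift {A : B} (x y : P.Fiber A) :
    incl.obj x ⊗ incl.obj y ⟶ incl.obj (tensorPush hP c x y) :=
  c.lift (addHom A) (hP.prod x y)

/-- The unit object `e_* I` of the fibre over `A`, where `e` is the neutral element of `A` and `I`
is the terminal object of `X`. -/
def unitPush (A : B) : P.Fiber A :=
  c.push (zeroHom A) hP.unit

/-- The cocartesian lifting `I ⟶ e_* I`. -/
def unitPushLift (A : B) : 𝟙_ X ⟶ incl.obj (unitPush hP c A) :=
  c.lift (zeroHom A) hP.unit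

/-- The tensor product and the unit object of a symmetric 2-group structure on the fibre over `A`
are `m_* (x × y)` and `e_* I`. -/
structure HasCanonicalObj (A : B) [SymmetricTwoGroup (P.Fiber A)] : Prop where
  tensor_eq (x y : P.Fiber A) : x ⊗ y = tensorPush hP c x y
  unit_eq : 𝟙_ (P.Fiber A) = unitPush hP c A

namespace HasCanonicalObj

variable {hP c} {A : B} [SymmetricTwoGroup (P.Fiber A)] (h : HasCanonicalObj hP c A)

/-- The cocartesian lifting `x × y ⟶ x ⊗ y` of the addition. -/
def tensorLift (x y : P.Fiber A) :
    incl.obj x ⊗ incl.obj y ⟶ incl.obj (x ⊗ y) :=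
  tensorPushLift hP c x y ≫ incl.map (eqToHom (h.tensor_eq x y).symm)

/-- The cocartesian lifting `I ⟶ 𝟙_` of the neutral element. -/
def unitLift : 𝟙_ X ⟶ incl.obj (𝟙_ (P.Fiber A)) :=
  unitPushLift hP c A ≫ incl.map (eqToHom h.unit_eq.symm)

/-- The tensor product of morphisms, the associator, the unitors and the braiding of the fibre are
induced by those of the cartesian monoidal category `X`, and `(-1)_* x` is a weak inverse of
`x`. -/
structure IsCanonical : Prop where
  tensorHom {x y x' y' : P.Fiber A} (φ : x ⟶ x') (ψ : y ⟶ y') :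
    h.tensorLift x y ≫ incl.map (φ ⊗ₘ ψ) =
      (incl.map φ ⊗ₘ incl.map ψ) ≫ h.tensorLift x' y'
  associator (x y z : P.Fiber A) :
    (h.tensorLift x y ▷ incl.obj z) ≫ h.tensorLift (x ⊗ y) z ≫ incl.map (α_ x y z).hom =
      (α_ (incl.obj x) (incl.obj y) (incl.obj z)).hom ≫
        (incl.obj x ◁ h.tensorLift y z) ≫ h.tensorLift x (y ⊗ z)
  leftUnitor (x : P.Fiber A) :
    (h.unitLift ▷ incl.obj x) ≫ h.tensorLift (𝟙_ _) x ≫ incl.map (λ_ x).hom =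
      snd (𝟙_ X) (incl.obj x)
  rightUnitor (x : P.Fiber A) :
    (incl.obj x ◁ h.unitLift) ≫ h.tensorLift x (𝟙_ _) ≫ incl.map (ρ_ x).hom =
      fst (incl.obj x) (𝟙_ X)
  braiding (x y : P.Fiber A) :
    h.tensorLift x y ≫ incl.map (β_ x y).hom =
      lift (snd (incl.obj x) (incl.obj y)) (fst (incl.obj x) (incl.obj y)) ≫ h.tensorLift y x
  inverse (x : P.Fiber A) : Nonempty (x ⊗ c.push (-𝟙 A) x ≅ 𝟙_ (P.Fiber A))

/-- The symmetric monoidal structure of the change of base functor `f_*` is induced by the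
products of the cocartesian liftings of `f`. -/
structure IsCanonicalMap {A' : B} [SymmetricTwoGroup (P.Fiber A')] (h' : HasCanonicalObj hP c A')
    (f : A ⟶ A') (M : (c.pushFunctor f).Braided) : Prop where
  unit : h'.unitLift ≫ incl.map (Functor.LaxMonoidal.ε (c.pushFunctor f)) =
    h.unitLift ≫ c.lift f (𝟙_ (P.Fiber A))
  tensor (x y : P.Fiber A) :
    (c.lift f x ⊗ₘ c.lift f y) ≫ h'.tensorLift (c.push f x) (c.push f y) ≫
      incl.map (Functor.LaxMonoidal.μ (c.pushFunctor f) x y) =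
    h.tensorLift x y ≫ c.lift f (x ⊗ y)

end HasCanonicalObj

/-- A factorization of the pseudofunctor associated with `P` through symmetric 2-groups is canonical
if the structure of the fibre over `A` is the one induced by the products of `X` and by the internal
abelian group structure of `A`. -/
structure IsCanonicalLift (L : SCGLift c.pseudofunctor) : Prop where
  obj (A : B) : @HasCanonicalObj _ _ _ _ _ _ _ _ hP c A (L.obj ⟨A⟩)
  isCanonical (A : B) : @HasCanonicalObj.IsCanonical _ _ _ _ _ _ _ _ hP c A (L.obj ⟨A⟩) (obj A)
  isCanonicalMap {A A' : B} (f : A ⟶ A') :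
    @HasCanonicalObj.IsCanonicalMap _ _ _ _ _ _ _ _ hP c A (L.obj ⟨A⟩) (obj A) A'
      (L.obj ⟨A'⟩) (obj A') f (L.map f.toLoc)

end Additive
end Cartesian
end Opfibrations
end TwoGroups

namespace TwoGroups

/-! ### Cocartesian arrows without a named base arrow. -/

section Cocartesian

variable {X : Type u₁} [Category.{v₁} X] {B : Type u₂} [Category.{v₂} B] {P : X ⥤ B}

/-! Cocartesian arrows are closed under composition and, by hypothesis, under products. So every
arrow from an iterated product in `X` to the corresponding iterated tensor product in a fibre, such
as `(x × y) × z ⟶ (x ⊗ y) ⊗ z`, is cocartesian. The abelian group laws of `A` say that two such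
arrows, built from different bracketings, orders or units, lie over the same arrow of `B`, possibly
after precomposing with a structural isomorphism of `X`. Comparing them yields the vertical
isomorphisms `tensorAssoc`, `tensorLeftUnitor`, `tensorRightUnitor` and `tensorBraiding`. Vertical
arrows out of the codomain of a cocartesian arrow are determined by precomposition with it
(`IsCocart.fiber_hom_ext`), and this reduces each coherence law to the corresponding law of the
cartesian structure of `X`.

Every arrow `f` of `B` is a homomorphism for these group structures, so the same comparison gives
`pushTensorIso` and `pushUnitIso`. Their coherence, and the monoidality of the structure cells of
the pseudofunctor, are again tested on cocartesian liftings.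

The assumptions on terminal maps and diagonals serve only to make the fibres 2-groups. The composite
`x ⟶ x × x ⟶ x × (-1)_* x ⟶ x ⊗ (-1)_* x` and the composite `x ⟶ I ⟶ E` are both cocartesian, and
both lie over `0 : A ⟶ A` since `1 + (-1) = 0`; hence `x ⊗ (-1)_* x ≅ E` (`tensorNegIso`). These
isomorphisms are compatible with every vertical `φ`, so `φ ⊗ (-1)_* φ` is invertible
(`isIso_tensorMap_neg`). Tensoring with an invertible object reflects split monomorphisms and split
epimorphisms, so `φ` itself is invertible (`isIso_of_isIso_tensorHom`) and the fibre is a groupoid.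
-/

theorem isCocart_of_isStronglyCocartesian {A A' : B} {f : A ⟶ A'} {x y : X} {φ : x ⟶ y}
    (h : P.IsStronglyCocartesian f φ) : IsCocart P φ := by
  -- Case analysis on the lifting relation replaces `f` by `P.map φ`.
  obtain ⟨⟩ := (inferInstance : P.IsHomLift f φ)
  exact h

theorem IsCocart.isStronglyCocartesian {A A' : B} {f : A ⟶ A'} {x y : X} {φ : x ⟶ y}
    (h : IsCocart P φ) (hφ : P.IsHomLift f φ) : P.IsStronglyCocartesian f φ := by
  obtain ⟨⟩ := hφ
  exact h

theorem IsCocart.comp {x y z : X} {φ : x ⟶ y} {ψ : y ⟶ z} (hφ : IsCocart P φ)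
    (hψ : IsCocart P ψ) : IsCocart P (φ ≫ ψ) :=
  isCocart_of_isStronglyCocartesian (f := P.map φ ≫ P.map ψ)
    (have := hφ; have := hψ; inferInstance)

theorem IsCocart.of_isIso {x y : X} (φ : x ⟶ y) [IsIso φ] : IsCocart P φ := inferInstance

/-- The tool for all coherence laws below. Since no base arrow is mentioned, equations between long
composites of `B` need not be checked in order to use it. -/
theorem IsCocart.fiber_hom_ext {A : B} {a : X} {x y : P.Fiber A} {l : a ⟶ incl.obj x}
    (hl : IsCocart P l) {φ ψ : x ⟶ y} (h : l ≫ incl.map φ = l ≫ incl.map ψ) : φ = ψ := by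
  obtain ⟨x, rfl⟩ := x
  exact @Opcleavage.fiber_hom_ext _ _ _ _ _ _ _ (P.map l) _ _ _ l hl _ _ h

theorem obj_incl {A : B} (x : P.Fiber A) : P.obj (incl.obj x) = A := x.2

/-- The entry point of the group laws: a composite that visibly lies over one side of such a law is
moved over the other side. -/
theorem isHomLift_congr {A A' : B} {f g : A ⟶ A'} {x y : X} {φ : x ⟶ y} (h : P.IsHomLift f φ)
    (hfg : f = g) : P.IsHomLift g φ := hfg ▸ h

theorem isCocart_lift (c : Opcleavage P) {A A' : B} (f : A ⟶ A') (x : P.Fiber A) :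
    IsCocart P (c.lift f x) :=
  isCocart_of_isStronglyCocartesian (c.isStronglyCocartesian f x)

end Cocartesian

/-! ### Liftings and cocartesian arrows under finite products. -/

section Products

variable {X : Type u₁} [Category.{v₁} X] [CartesianMonoidalCategory X]
  {B : Type u₂} [Category.{v₂} B] [CartesianMonoidalCategory B] {P : X ⥤ B}

theorem associator_hom_eq_lift (x y z : X) : (α_ x y z).hom =
    lift (fst _ _ ≫ fst _ _) (lift (fst _ _ ≫ snd _ _) (snd _ _)) := by
  ext <;> simp

namespace IsCartesianMonoidalOpfibration

variable (hP : IsCartesianMonoidalOpfibration P)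
include hP

theorem isHomLift_fst {A A' : B} {x y : X} (hx : P.obj x = A) (hy : P.obj y = A') :
    P.IsHomLift (fst A A') (fst x y) := by
  subst hx hy; exact hP.fst_isHomLift x y

theorem isHomLift_snd {A A' : B} {x y : X} (hx : P.obj x = A) (hy : P.obj y = A') :
    P.IsHomLift (snd A A') (snd x y) := by
  subst hx hy; exact hP.snd_isHomLift x y

theorem isHomLift_lift {A A' A'' : B} {f : A ⟶ A'} {g : A ⟶ A''} {x y z : X} {φ : x ⟶ y}
    {ψ : x ⟶ z} (hφ : P.IsHomLift f φ) (hψ : P.IsHomLift g ψ) :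
    P.IsHomLift (lift f g) (lift φ ψ) := by
  obtain ⟨⟩ := hφ
  obtain rfl := IsHomLift.codomain_eq P g ψ
  obtain rfl := IsHomLift.eq_of_isHomLift P g ψ
  have h₁ := hP.fst_isHomLift y z
  have h₂ := hP.snd_isHomLift y z
  have e₁ := IsHomLift.fac P (fst (P.obj y) (P.obj z)) (fst y z)
  have e₂ := IsHomLift.fac P (snd (P.obj y) (P.obj z)) (snd y z)
  -- The identity `P (y ⊗ z) = P y ⊗ P z` is only propositional, so the goal carries an `eqToHom`.
  -- It is tested on the two projections, which `e₁` and `e₂` express through `P.map` and the same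
  -- transport.
  refine IsHomLift.of_fac P _ _ rfl (hP.obj_tensor y z) ?_
  apply CartesianMonoidalCategory.hom_ext
  · rw [lift_fst, e₁]; simp [← Functor.map_comp]
  · rw [lift_snd, e₂]; simp [← Functor.map_comp]

theorem isHomLift_tensorHom {A A' A'' A''' : B} {f : A ⟶ A'} {g : A'' ⟶ A'''} {x y z w : X}
    {φ : x ⟶ y} {ψ : z ⟶ w} (hφ : P.IsHomLift f φ) (hψ : P.IsHomLift g ψ) :
    P.IsHomLift (f ⊗ₘ g) (φ ⊗ₘ ψ) := by
  have h₁ := hP.isHomLift_fst (IsHomLift.domain_eq P f φ) (IsHomLift.domain_eq P g ψ)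
  have h₂ := hP.isHomLift_snd (IsHomLift.domain_eq P f φ) (IsHomLift.domain_eq P g ψ)
  rw [← lift_fst_comp_snd_comp, ← lift_fst_comp_snd_comp]
  exact hP.isHomLift_lift inferInstance inferInstance

theorem isHomLift_whiskerRight {A A' A'' : B} {f : A ⟶ A'} {x y z : X} {φ : x ⟶ y}
    (hφ : P.IsHomLift f φ) (hz : P.obj z = A'') : P.IsHomLift (f ▷ A'') (φ ▷ z) := by
  rw [← tensorHom_id, ← tensorHom_id]
  exact hP.isHomLift_tensorHom hφ (IsHomLift.id hz)

theorem isHomLift_whiskerLeft {A A' A'' : B} {f : A ⟶ A'} {x y z : X} {φ : x ⟶ y}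
    (hφ : P.IsHomLift f φ) (hz : P.obj z = A'') : P.IsHomLift (A'' ◁ f) (z ◁ φ) := by
  rw [← id_tensorHom, ← id_tensorHom]
  exact hP.isHomLift_tensorHom (IsHomLift.id hz) hφ

theorem isHomLift_associator {A A' A'' : B} {x y z : X} (hx : P.obj x = A) (hy : P.obj y = A')
    (hz : P.obj z = A'') : P.IsHomLift (α_ A A' A'').hom (α_ x y z).hom := by
  have hxy : P.obj (x ⊗ y) = A ⊗ A' := by rw [hP.obj_tensor, hx, hy]
  have h₁ := hP.isHomLift_fst hxy hz
  have h₂ := hP.isHomLift_snd hxy hz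
  have h₃ := hP.isHomLift_fst hx hy
  have h₄ := hP.isHomLift_snd hx hy
  rw [associator_hom_eq_lift, associator_hom_eq_lift]
  exact hP.isHomLift_lift inferInstance (hP.isHomLift_lift inferInstance inferInstance)

theorem isHomLift_toUnit {A : B} {x : X} (hx : P.obj x = A) :
    P.IsHomLift (toUnit A) (toUnit x) :=
  IsHomLift.of_fac P _ _ hx hP.obj_unit (toUnit_unique _ _)

theorem isCocart_whiskerRight {x y : X} {φ : x ⟶ y} (hφ : IsCocart P φ) (z : X) :
    IsCocart P (φ ▷ z) := by
  rw [← tensorHom_id]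
  exact hP.tensor_isCocart _ _ hφ (.of_isIso _)

theorem isCocart_whiskerLeft {x y : X} {φ : x ⟶ y} (hφ : IsCocart P φ) (z : X) :
    IsCocart P (z ◁ φ) := by
  rw [← id_tensorHom]
  exact hP.tensor_isCocart _ _ (.of_isIso _) hφ

end IsCartesianMonoidalOpfibration

theorem isCocart_lift_tensorHom_lift (hP : IsCartesianMonoidalOpfibration P) (c : Opcleavage P) {A A' : B}
    (f : A ⟶ A') (x y : P.Fiber A) :
    IsCocart P (c.lift f x ⊗ₘ c.lift f y) :=
  hP.tensor_isCocart _ _ (isCocart_lift c f x) (isCocart_lift c f y)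

end Products

/-! ### The internal abelian group laws of an object of `B`. -/

section Addition

variable {B : Type u₂} [Category.{v₂} B] [CartesianMonoidalCategory B] [Preadditive B]

theorem addHom_assoc (A : B) :
    (α_ A A A).hom ≫ (A ◁ addHom A) ≫ addHom A = (addHom A ▷ A) ≫ addHom A := by
  simp [addHom, add_assoc]

theorem addHom_comm (A : B) : lift (snd A A) (fst A A) ≫ addHom A = addHom A := by
  simp [addHom, add_comm]

theorem zeroHom_addHom (A : B) : (zeroHom A ▷ A) ≫ addHom A = snd (𝟙_ B) A := by
  simp [addHom, zeroHom]

theorem addHom_zeroHom (A : B) : (A ◁ zeroHom A) ≫ addHom A = fst A (𝟙_ B) := by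
  simp [addHom, zeroHom]

/-- Composition is bilinear, so each arrow is a homomorphism of internal groups; this is what makes
`f_*` monoidal. -/
theorem tensorHom_addHom {A A' : B} (f : A ⟶ A') :
    (f ⊗ₘ f) ≫ addHom A' = addHom A ≫ f := by
  simp [addHom]

theorem zeroHom_comp {A A' : B} (f : A ⟶ A') : zeroHom A ≫ f = zeroHom A' := by
  simp [zeroHom]

end Addition

end TwoGroups
namespace TwoGroups

open Opcleavage

/-! ### Tensor product and structure isomorphisms of a fibre. -/

section FiberMonoidal

variable {X : Type u₁} [Category.{v₁} X] [CartesianMonoidalCategory X]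
  {B : Type u₂} [Category.{v₂} B] [CartesianMonoidalCategory B] [Preadditive B]
  {P : X ⥤ B} (hP : IsCartesianMonoidalOpfibration P) (c : Opcleavage P) {A : B}

instance (x y : P.Fiber A) : P.IsStronglyCocartesian (addHom A) (tensorPushLift hP c x y) :=
  c.isStronglyCocartesian (addHom A) (hP.prod x y)

instance (A : B) : P.IsStronglyCocartesian (zeroHom A) (unitPushLift hP c A) :=
  c.isStronglyCocartesian (zeroHom A) hP.unit

theorem isCocart_tensorPushLift (x y : P.Fiber A) : IsCocart P (tensorPushLift hP c x y) :=
  isCocart_of_isStronglyCocartesian (f := addHom A) inferInstance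

theorem isCocart_unitPushLift (A : B) : IsCocart P (unitPushLift hP c A) :=
  isCocart_of_isStronglyCocartesian (f := zeroHom A) inferInstance

/-- The tensor product of morphisms of the fibre over `A`. -/
noncomputable def tensorMap {x y x' y' : P.Fiber A} (φ : x ⟶ x') (ψ : y ⟶ y') :
    tensorPush hP c x y ⟶ tensorPush hP c x' y' :=
  desc (addHom A) (tensorPushLift hP c x y)
    ((incl.map φ ⊗ₘ incl.map ψ) ≫ tensorPushLift hP c x' y') inferInstance
    (have := hP.isHomLift_tensorHom (f := 𝟙 A) (g := 𝟙 A) (φ := incl.map φ) (ψ := incl.map ψ)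
      inferInstance inferInstance
    isHomLift_congr (f := (𝟙 A ⊗ₘ 𝟙 A) ≫ addHom A) inferInstance (by simp))

@[simp]
theorem tensorPushLift_tensorMap {x y x' y' : P.Fiber A} (φ : x ⟶ x') (ψ : y ⟶ y') :
    tensorPushLift hP c x y ≫ incl.map (tensorMap hP c φ ψ) =
      (incl.map φ ⊗ₘ incl.map ψ) ≫ tensorPushLift hP c x' y' :=
  fac _ _ _ _ _

@[simp]
theorem tensorPushLift_tensorMap_assoc {x y x' y' : P.Fiber A} (φ : x ⟶ x') (ψ : y ⟶ y') {a : X}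
    (k : incl.obj (tensorPush hP c x' y') ⟶ a) :
    tensorPushLift hP c x y ≫ incl.map (tensorMap hP c φ ψ) ≫ k =
      (incl.map φ ⊗ₘ incl.map ψ) ≫ tensorPushLift hP c x' y' ≫ k := by
  simpa only [Category.assoc] using congrArg (· ≫ k) (tensorPushLift_tensorMap hP c φ ψ)

/-- Closure under products handles the whiskered lifting, closure under composition the rest.
Vertical arrows out of a triple tensor product can thus be tested on `(x × y) × z`. -/
theorem isCocart_tensorPushLift_left (x y z : P.Fiber A) :
    IsCocart P ((tensorPushLift hP c x y ▷ incl.obj z) ≫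
      tensorPushLift hP c (tensorPush hP c x y) z) :=
  (hP.isCocart_whiskerRight (isCocart_tensorPushLift hP c x y) _).comp
    (isCocart_tensorPushLift hP c _ z)

theorem isCocart_tensorPushLift_right (x y z : P.Fiber A) :
    IsCocart P ((incl.obj x ◁ tensorPushLift hP c y z) ≫
      tensorPushLift hP c x (tensorPush hP c y z)) :=
  (hP.isCocart_whiskerLeft (isCocart_tensorPushLift hP c y z) _).comp
    (isCocart_tensorPushLift hP c x _)

/-- The associator of the fibre over `A`. -/
noncomputable def tensorAssoc (x y z : P.Fiber A) :
    tensorPush hP c (tensorPush hP c x y) z ≅ tensorPush hP c x (tensorPush hP c y z) :=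
  vertIso ((addHom A ▷ A) ≫ addHom A)
    ((tensorPushLift hP c x y ▷ incl.obj z) ≫ tensorPushLift hP c (tensorPush hP c x y) z)
    ((α_ (incl.obj x) (incl.obj y) (incl.obj z)).hom ≫
      (incl.obj x ◁ tensorPushLift hP c y z) ≫ tensorPushLift hP c x (tensorPush hP c y z))
    ((isCocart_tensorPushLift_left hP c x y z).isStronglyCocartesian
      (have := hP.isHomLift_whiskerRight (f := addHom A) (φ := tensorPushLift hP c x y)
        inferInstance (obj_incl z)
      inferInstance))
    ((IsCocart.of_isIso _).comp
      (isCocart_tensorPushLift_right hP c x y z) |>.isStronglyCocartesian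
      (have := hP.isHomLift_whiskerLeft (f := addHom A) (φ := tensorPushLift hP c y z)
        inferInstance (obj_incl x)
      have := hP.isHomLift_associator (obj_incl x) (obj_incl y) (obj_incl z)
      isHomLift_congr (f := (α_ A A A).hom ≫ (A ◁ addHom A) ≫ addHom A) inferInstance
        (addHom_assoc A)))

@[simp]
theorem tensorPushLift_tensorAssoc (x y z : P.Fiber A) :
    (tensorPushLift hP c x y ▷ incl.obj z) ≫ tensorPushLift hP c (tensorPush hP c x y) z ≫
        incl.map (tensorAssoc hP c x y z).hom =
      (α_ (incl.obj x) (incl.obj y) (incl.obj z)).hom ≫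
        (incl.obj x ◁ tensorPushLift hP c y z) ≫
          tensorPushLift hP c x (tensorPush hP c y z) := by
  rw [← Category.assoc]
  exact comp_vertIso_hom _ _ _ _ _

@[simp]
theorem tensorPushLift_tensorAssoc_assoc (x y z : P.Fiber A) {a : X}
    (k : incl.obj (tensorPush hP c x (tensorPush hP c y z)) ⟶ a) :
    (tensorPushLift hP c x y ▷ incl.obj z) ≫ tensorPushLift hP c (tensorPush hP c x y) z ≫
        incl.map (tensorAssoc hP c x y z).hom ≫ k =
      (α_ (incl.obj x) (incl.obj y) (incl.obj z)).hom ≫ (incl.obj x ◁ tensorPushLift hP c y z) ≫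
        tensorPushLift hP c x (tensorPush hP c y z) ≫ k := by
  simpa only [Category.assoc] using congrArg (· ≫ k) (tensorPushLift_tensorAssoc hP c x y z)

theorem isCocart_unitPushLift_left (x : P.Fiber A) :
    IsCocart P ((unitPushLift hP c A ▷ incl.obj x) ≫
      tensorPushLift hP c (unitPush hP c A) x) :=
  (hP.isCocart_whiskerRight (isCocart_unitPushLift hP c A) _).comp
    (isCocart_tensorPushLift hP c _ x)

theorem isCocart_unitPushLift_right (x : P.Fiber A) :
    IsCocart P ((incl.obj x ◁ unitPushLift hP c A) ≫
      tensorPushLift hP c x (unitPush hP c A)) :=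
  (hP.isCocart_whiskerLeft (isCocart_unitPushLift hP c A) _).comp
    (isCocart_tensorPushLift hP c x _)

theorem isIso_snd_unit (x : X) : IsIso (snd (𝟙_ X) x) := by
  rw [← leftUnitor_hom]; infer_instance

theorem isIso_fst_unit (x : X) : IsIso (fst x (𝟙_ X)) := by
  rw [← rightUnitor_hom]; infer_instance

/-- The left unitor of the fibre over `A`. -/
noncomputable def tensorLeftUnitor (x : P.Fiber A) :
    tensorPush hP c (unitPush hP c A) x ≅ x :=
  vertIso (snd (𝟙_ B) A)
    ((unitPushLift hP c A ▷ incl.obj x) ≫ tensorPushLift hP c (unitPush hP c A) x)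
    (snd (𝟙_ X) (incl.obj x))
    ((isCocart_unitPushLift_left hP c x).isStronglyCocartesian
      (have := hP.isHomLift_whiskerRight (f := zeroHom A) (φ := unitPushLift hP c A)
        inferInstance (obj_incl x)
      isHomLift_congr (f := (zeroHom A ▷ A) ≫ addHom A) inferInstance (zeroHom_addHom A)))
    -- The projection `I × x ⟶ x` is invertible, hence cocartesian, and by the unit law it lies over
    -- the same arrow as the lifting `I × x ⟶ E ⊗ x`.
    (have := isIso_snd_unit (incl.obj x)
    (IsCocart.of_isIso _).isStronglyCocartesian (hP.isHomLift_snd hP.obj_unit (obj_incl x)))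

@[simp]
theorem tensorPushLift_tensorLeftUnitor (x : P.Fiber A) :
    (unitPushLift hP c A ▷ incl.obj x) ≫ tensorPushLift hP c (unitPush hP c A) x ≫
      incl.map (tensorLeftUnitor hP c x).hom = snd (𝟙_ X) (incl.obj x) := by
  rw [← Category.assoc]
  exact comp_vertIso_hom _ _ _ _ _

@[simp]
theorem tensorPushLift_tensorLeftUnitor_assoc (x : P.Fiber A) {a : X}
    (k : incl.obj x ⟶ a) :
    (unitPushLift hP c A ▷ incl.obj x) ≫ tensorPushLift hP c (unitPush hP c A) x ≫
        incl.map (tensorLeftUnitor hP c x).hom ≫ k =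
      snd (𝟙_ X) (incl.obj x) ≫ k := by
  simpa only [Category.assoc] using congrArg (· ≫ k) (tensorPushLift_tensorLeftUnitor hP c x)

/-- The right unitor of the fibre over `A`. -/
noncomputable def tensorRightUnitor (x : P.Fiber A) :
    tensorPush hP c x (unitPush hP c A) ≅ x :=
  vertIso (fst A (𝟙_ B))
    ((incl.obj x ◁ unitPushLift hP c A) ≫ tensorPushLift hP c x (unitPush hP c A))
    (fst (incl.obj x) (𝟙_ X))
    ((isCocart_unitPushLift_right hP c x).isStronglyCocartesian
      (have := hP.isHomLift_whiskerLeft (f := zeroHom A) (φ := unitPushLift hP c A)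
        inferInstance (obj_incl x)
      isHomLift_congr (f := (A ◁ zeroHom A) ≫ addHom A) inferInstance (addHom_zeroHom A)))
    (have := isIso_fst_unit (incl.obj x)
    (IsCocart.of_isIso _).isStronglyCocartesian (hP.isHomLift_fst (obj_incl x) hP.obj_unit))

@[simp]
theorem tensorPushLift_tensorRightUnitor (x : P.Fiber A) :
    (incl.obj x ◁ unitPushLift hP c A) ≫ tensorPushLift hP c x (unitPush hP c A) ≫
      incl.map (tensorRightUnitor hP c x).hom = fst (incl.obj x) (𝟙_ X) := by
  rw [← Category.assoc]
  exact comp_vertIso_hom _ _ _ _ _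

@[simp]
theorem tensorPushLift_tensorRightUnitor_assoc (x : P.Fiber A) {a : X}
    (k : incl.obj x ⟶ a) :
    (incl.obj x ◁ unitPushLift hP c A) ≫ tensorPushLift hP c x (unitPush hP c A) ≫
        incl.map (tensorRightUnitor hP c x).hom ≫ k =
      fst (incl.obj x) (𝟙_ X) ≫ k := by
  simpa only [Category.assoc] using congrArg (· ≫ k) (tensorPushLift_tensorRightUnitor hP c x)

theorem isIso_lift_snd_fst (x y : X) : IsIso (lift (snd x y) (fst x y)) :=
  ⟨lift (snd y x) (fst y x), by ext <;> simp, by ext <;> simp⟩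

/-- The braiding of the fibre over `A`. -/
noncomputable def tensorBraiding (x y : P.Fiber A) : tensorPush hP c x y ≅ tensorPush hP c y x :=
  vertIso (addHom A) (tensorPushLift hP c x y)
    (lift (snd (incl.obj x) (incl.obj y)) (fst (incl.obj x) (incl.obj y)) ≫
      tensorPushLift hP c y x) inferInstance
    (have := isIso_lift_snd_fst (incl.obj x) (incl.obj y)
    ((IsCocart.of_isIso _).comp (isCocart_tensorPushLift hP c y x)).isStronglyCocartesian
      (have := hP.isHomLift_lift (hP.isHomLift_snd (obj_incl x) (obj_incl y))
        (hP.isHomLift_fst (obj_incl x) (obj_incl y))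
      isHomLift_congr (f := lift (snd A A) (fst A A) ≫ addHom A) inferInstance (addHom_comm A)))

@[simp]
theorem tensorPushLift_tensorBraiding (x y : P.Fiber A) :
    tensorPushLift hP c x y ≫ incl.map (tensorBraiding hP c x y).hom =
      lift (snd (incl.obj x) (incl.obj y)) (fst (incl.obj x) (incl.obj y)) ≫
        tensorPushLift hP c y x :=
  comp_vertIso_hom _ _ _ _ _

@[simp]
theorem tensorPushLift_tensorBraiding_assoc (x y : P.Fiber A) {a : X}
    (k : incl.obj (tensorPush hP c y x) ⟶ a) :
    tensorPushLift hP c x y ≫ incl.map (tensorBraiding hP c x y).hom ≫ k =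
      lift (snd (incl.obj x) (incl.obj y)) (fst (incl.obj x) (incl.obj y)) ≫
        tensorPushLift hP c y x ≫ k := by
  simpa only [Category.assoc] using congrArg (· ≫ k) (tensorPushLift_tensorBraiding hP c x y)

end FiberMonoidal

end TwoGroups
namespace TwoGroups

open Opcleavage

/-! ### Coherence: the fibres are symmetric monoidal. -/

section FiberCoherence

variable {X : Type u₁} [Category.{v₁} X] [CartesianMonoidalCategory X]
  {B : Type u₂} [Category.{v₂} B] [CartesianMonoidalCategory B] [Preadditive B]
  {P : X ⥤ B} (hP : IsCartesianMonoidalOpfibration P) (c : Opcleavage P) {A : B}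

theorem isCocart_tensorPushLift_left_left (x y z w : P.Fiber A) :
    IsCocart P (((tensorPushLift hP c x y ▷ incl.obj z) ▷ incl.obj w) ≫
      (tensorPushLift hP c (tensorPush hP c x y) z ▷ incl.obj w) ≫
        tensorPushLift hP c (tensorPush hP c (tensorPush hP c x y) z) w) :=
  (hP.isCocart_whiskerRight
    (hP.isCocart_whiskerRight (isCocart_tensorPushLift hP c x y) _) _).comp
    (isCocart_tensorPushLift_left hP c _ z w)

@[simp]
theorem tensorMap_id (x y : P.Fiber A) :
    tensorMap hP c (𝟙 x) (𝟙 y) = 𝟙 (tensorPush hP c x y) :=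
  (isCocart_tensorPushLift hP c x y).fiber_hom_ext (by simp)

theorem tensorMap_comp {x y z x' y' z' : P.Fiber A} (φ : x ⟶ y) (ψ : y ⟶ z) (φ' : x' ⟶ y')
    (ψ' : y' ⟶ z') :
    tensorMap hP c φ φ' ≫ tensorMap hP c ψ ψ' = tensorMap hP c (φ ≫ ψ) (φ' ≫ ψ') :=
  (isCocart_tensorPushLift hP c x x').fiber_hom_ext (by simp)

theorem tensorAssoc_naturality {x₁ x₂ x₃ y₁ y₂ y₃ : P.Fiber A} (φ₁ : x₁ ⟶ y₁) (φ₂ : x₂ ⟶ y₂)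
    (φ₃ : x₃ ⟶ y₃) :
    tensorMap hP c (tensorMap hP c φ₁ φ₂) φ₃ ≫ (tensorAssoc hP c y₁ y₂ y₃).hom =
      (tensorAssoc hP c x₁ x₂ x₃).hom ≫ tensorMap hP c φ₁ (tensorMap hP c φ₂ φ₃) := by
  refine (isCocart_tensorPushLift_left hP c x₁ x₂ x₃).fiber_hom_ext ?_
  have h₁ : tensorPushLift hP c x₁ x₂ ▷ incl.obj x₃ ≫
      (incl.map (tensorMap hP c φ₁ φ₂) ⊗ₘ incl.map φ₃) =
        ((incl.map φ₁ ⊗ₘ incl.map φ₂) ⊗ₘ incl.map φ₃) ≫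
          tensorPushLift hP c y₁ y₂ ▷ incl.obj y₃ := by
    rw [← tensorHom_id, ← tensorHom_id, tensorHom_comp_tensorHom, tensorHom_comp_tensorHom,
      tensorPushLift_tensorMap, Category.id_comp, Category.comp_id]
  have h₂ : incl.obj x₁ ◁ tensorPushLift hP c x₂ x₃ ≫
      (incl.map φ₁ ⊗ₘ incl.map (tensorMap hP c φ₂ φ₃)) =
        (incl.map φ₁ ⊗ₘ (incl.map φ₂ ⊗ₘ incl.map φ₃)) ≫
          incl.obj y₁ ◁ tensorPushLift hP c y₂ y₃ := by
    rw [← id_tensorHom, ← id_tensorHom, tensorHom_comp_tensorHom, tensorHom_comp_tensorHom,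
      tensorPushLift_tensorMap, Category.id_comp, Category.comp_id]
  simp [reassoc_of% h₁, reassoc_of% h₂]

theorem tensorLeftUnitor_naturality {x y : P.Fiber A} (φ : x ⟶ y) :
    tensorMap hP c (𝟙 (unitPush hP c A)) φ ≫ (tensorLeftUnitor hP c y).hom =
      (tensorLeftUnitor hP c x).hom ≫ φ := by
  refine (isCocart_unitPushLift_left hP c x).fiber_hom_ext ?_
  simp [← MonoidalCategory.whisker_exchange_assoc, ← leftUnitor_hom]

theorem tensorRightUnitor_naturality {x y : P.Fiber A} (φ : x ⟶ y) :
    tensorMap hP c φ (𝟙 (unitPush hP c A)) ≫ (tensorRightUnitor hP c y).hom =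
      (tensorRightUnitor hP c x).hom ≫ φ := by
  refine (isCocart_unitPushLift_right hP c x).fiber_hom_ext ?_
  simp [MonoidalCategory.whisker_exchange_assoc, ← rightUnitor_hom]

theorem tensorPushLift_whiskerRight_tensorAssoc (x y z : P.Fiber A) (w : X) :
    (tensorPushLift hP c x y ▷ incl.obj z) ▷ w ≫
      tensorPushLift hP c (tensorPush hP c x y) z ▷ w ≫
        incl.map (tensorAssoc hP c x y z).hom ▷ w =
      (α_ (incl.obj x) (incl.obj y) (incl.obj z)).hom ▷ w ≫
        (incl.obj x ◁ tensorPushLift hP c y z) ▷ w ≫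
          tensorPushLift hP c x (tensorPush hP c y z) ▷ w := by
  simp only [← MonoidalCategory.comp_whiskerRight, tensorPushLift_tensorAssoc]

theorem tensorPushLift_whiskerLeft_tensorAssoc (x y z : P.Fiber A) (w : X) :
    w ◁ (tensorPushLift hP c x y ▷ incl.obj z) ≫
      w ◁ tensorPushLift hP c (tensorPush hP c x y) z ≫
        w ◁ incl.map (tensorAssoc hP c x y z).hom =
      w ◁ (α_ (incl.obj x) (incl.obj y) (incl.obj z)).hom ≫
        w ◁ (incl.obj x ◁ tensorPushLift hP c y z) ≫
          w ◁ tensorPushLift hP c x (tensorPush hP c y z) := by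
  simp only [← MonoidalCategory.whiskerLeft_comp, tensorPushLift_tensorAssoc]

/-- Precomposed with the cocartesian arrow out of `((x × y) × z) × w`, both sides become the two
sides of the pentagon of `X`, followed by the same lifting to `x ⊗ (y ⊗ (z ⊗ w))`. -/
theorem tensorAssoc_pentagon (x y z w : P.Fiber A) :
    tensorMap hP c (tensorAssoc hP c x y z).hom (𝟙 w) ≫
      (tensorAssoc hP c x (tensorPush hP c y z) w).hom ≫
        tensorMap hP c (𝟙 x) (tensorAssoc hP c y z w).hom =
      (tensorAssoc hP c (tensorPush hP c x y) z w).hom ≫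
        (tensorAssoc hP c x y (tensorPush hP c z w)).hom := by
  refine (isCocart_tensorPushLift_left_left hP c x y z w).fiber_hom_ext ?_
  have h₁ := tensorPushLift_whiskerRight_tensorAssoc hP c x y z (incl.obj w)
  have h₂ := tensorPushLift_whiskerLeft_tensorAssoc hP c y z w (incl.obj x)
  -- The liftings of `x × y` and of `z × w` act on disjoint factors, so they can be exchanged.
  have h₃ : (tensorPushLift hP c x y ▷ incl.obj z) ▷ incl.obj w ≫
      (α_ (incl.obj (tensorPush hP c x y)) (incl.obj z) (incl.obj w)).hom ≫
        incl.obj (tensorPush hP c x y) ◁ tensorPushLift hP c z w =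
      (α_ (incl.obj x ⊗ incl.obj y) (incl.obj z) (incl.obj w)).hom ≫
        (incl.obj x ⊗ incl.obj y) ◁ tensorPushLift hP c z w ≫
          tensorPushLift hP c x y ▷ incl.obj (tensorPush hP c z w) := by
    rw [MonoidalCategory.associator_naturality_left_assoc,
      ← MonoidalCategory.whisker_exchange]
  simp [reassoc_of% h₁, reassoc_of% h₂, reassoc_of% h₃]

theorem tensorUnitor_triangle (x y : P.Fiber A) :
    (tensorAssoc hP c x (unitPush hP c A) y).hom ≫
      tensorMap hP c (𝟙 x) (tensorLeftUnitor hP c y).hom =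
        tensorMap hP c (tensorRightUnitor hP c x).hom (𝟙 y) := by
  refine ((hP.isCocart_whiskerRight (hP.isCocart_whiskerLeft (isCocart_unitPushLift hP c A)
    (incl.obj x)) (incl.obj y)).comp
      (isCocart_tensorPushLift_left hP c x (unitPush hP c A) y)).fiber_hom_ext ?_
  have h₁ : incl.obj x ◁ unitPushLift hP c A ▷ incl.obj y ≫
      incl.obj x ◁ tensorPushLift hP c (unitPush hP c A) y ≫
        incl.obj x ◁ incl.map (tensorLeftUnitor hP c y).hom =
      incl.obj x ◁ snd (𝟙_ X) (incl.obj y) := by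
    simp only [← MonoidalCategory.whiskerLeft_comp, tensorPushLift_tensorLeftUnitor]
  have h₂ : (incl.obj x ◁ unitPushLift hP c A) ▷ incl.obj y ≫
      tensorPushLift hP c x (unitPush hP c A) ▷ incl.obj y ≫
        incl.map (tensorRightUnitor hP c x).hom ▷ incl.obj y =
      fst (incl.obj x) (𝟙_ X) ▷ incl.obj y := by
    simp only [← MonoidalCategory.comp_whiskerRight, tensorPushLift_tensorRightUnitor]
  have h₃ : (α_ (incl.obj x) (𝟙_ X) (incl.obj y)).hom ≫ incl.obj x ◁ snd (𝟙_ X) (incl.obj y) =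
      fst (incl.obj x) (𝟙_ X) ▷ incl.obj y := by
    ext <;> simp
  -- The doubly whiskered arrow is put in the normal form of `simp`, so that `h₂` still matches in
  -- the final call.
  simp only [MonoidalCategory.whisker_assoc] at h₂
  simp [reassoc_of% h₁, reassoc_of% h₂, reassoc_of% h₃]

theorem tensorBraiding_naturality {x y x' y' : P.Fiber A} (φ : x ⟶ x') (ψ : y ⟶ y') :
    tensorMap hP c φ ψ ≫ (tensorBraiding hP c x' y').hom =
      (tensorBraiding hP c x y).hom ≫ tensorMap hP c ψ φ := by
  refine (isCocart_tensorPushLift hP c x y).fiber_hom_ext ?_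
  have h : (incl.map φ ⊗ₘ incl.map ψ) ≫
      CartesianMonoidalCategory.lift (snd (incl.obj x') (incl.obj y')) (fst _ _) =
      CartesianMonoidalCategory.lift (snd (incl.obj x) (incl.obj y)) (fst _ _) ≫
        (incl.map ψ ⊗ₘ incl.map φ) := by
    ext <;> simp
  simp [reassoc_of% h]

theorem tensorBraiding_symmetry (x y : P.Fiber A) :
    (tensorBraiding hP c x y).hom ≫ (tensorBraiding hP c y x).hom = 𝟙 _ := by
  refine (isCocart_tensorPushLift hP c x y).fiber_hom_ext ?_
  have h : CartesianMonoidalCategory.lift (snd (incl.obj x) (incl.obj y)) (fst _ _) ≫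
      CartesianMonoidalCategory.lift (snd (incl.obj y) (incl.obj x)) (fst _ _) = 𝟙 _ := by
    ext <;> simp
  simp [reassoc_of% h]

/-- `h₁` and `h₂` move the braidings of the factors across the liftings, `h₃` is naturality of the
swap of `X`, and `h₄` is the hexagon of `X`, checked on projections. -/
theorem tensorBraiding_hexagon (x y z : P.Fiber A) :
    (tensorAssoc hP c x y z).hom ≫ (tensorBraiding hP c x (tensorPush hP c y z)).hom ≫
      (tensorAssoc hP c y z x).hom =
      tensorMap hP c (tensorBraiding hP c x y).hom (𝟙 z) ≫ (tensorAssoc hP c y x z).hom ≫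
        tensorMap hP c (𝟙 y) (tensorBraiding hP c x z).hom := by
  refine (isCocart_tensorPushLift_left hP c x y z).fiber_hom_ext ?_
  have h₁ : tensorPushLift hP c x y ▷ incl.obj z ≫
      incl.map (tensorBraiding hP c x y).hom ▷ incl.obj z =
      CartesianMonoidalCategory.lift (snd (incl.obj x) (incl.obj y)) (fst _ _) ▷ incl.obj z ≫
        tensorPushLift hP c y x ▷ incl.obj z := by
    simp only [← MonoidalCategory.comp_whiskerRight, tensorPushLift_tensorBraiding]
  have h₂ : incl.obj y ◁ tensorPushLift hP c x z ≫
      incl.obj y ◁ incl.map (tensorBraiding hP c x z).hom =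
      incl.obj y ◁ CartesianMonoidalCategory.lift (snd (incl.obj x) (incl.obj z)) (fst _ _) ≫
        incl.obj y ◁ tensorPushLift hP c z x := by
    simp only [← MonoidalCategory.whiskerLeft_comp, tensorPushLift_tensorBraiding]
  have h₃ : incl.obj x ◁ tensorPushLift hP c y z ≫ CartesianMonoidalCategory.lift (snd _ _)
      (fst (incl.obj x) (incl.obj (tensorPush hP c y z))) =
      CartesianMonoidalCategory.lift (snd _ _) (fst _ _) ≫
        tensorPushLift hP c y z ▷ incl.obj x := by
    ext <;> simp
  have h₄ : (α_ (incl.obj x) (incl.obj y) (incl.obj z)).hom ≫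
      CartesianMonoidalCategory.lift (snd _ _) (fst _ _) ≫
        (α_ (incl.obj y) (incl.obj z) (incl.obj x)).hom =
      CartesianMonoidalCategory.lift (snd (incl.obj x) (incl.obj y)) (fst _ _) ▷ incl.obj z ≫
        (α_ (incl.obj y) (incl.obj x) (incl.obj z)).hom ≫
        incl.obj y ◁ CartesianMonoidalCategory.lift (snd (incl.obj x) (incl.obj z)) (fst _ _) := by
    ext <;> simp
  simp [reassoc_of% h₁, reassoc_of% h₂, reassoc_of% h₃, reassoc_of% h₄]

@[simp]
theorem tensorPushLift_tensorAssoc_inv (x y z : P.Fiber A) :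
    (incl.obj x ◁ tensorPushLift hP c y z) ≫ tensorPushLift hP c x (tensorPush hP c y z) ≫
        incl.map (tensorAssoc hP c x y z).inv =
      (α_ (incl.obj x) (incl.obj y) (incl.obj z)).inv ≫
        (tensorPushLift hP c x y ▷ incl.obj z) ≫
          tensorPushLift hP c (tensorPush hP c x y) z := by
  rw [← cancel_epi (α_ (incl.obj x) (incl.obj y) (incl.obj z)).hom, Iso.hom_inv_id_assoc,
    ← tensorPushLift_tensorAssoc_assoc, ← Functor.map_comp, Iso.hom_inv_id]
  simp

@[simp]
theorem tensorPushLift_tensorAssoc_inv_assoc (x y z : P.Fiber A) {a : X}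
    (k : incl.obj (tensorPush hP c (tensorPush hP c x y) z) ⟶ a) :
    (incl.obj x ◁ tensorPushLift hP c y z) ≫ tensorPushLift hP c x (tensorPush hP c y z) ≫
        incl.map (tensorAssoc hP c x y z).inv ≫ k =
      (α_ (incl.obj x) (incl.obj y) (incl.obj z)).inv ≫ (tensorPushLift hP c x y ▷ incl.obj z) ≫
        tensorPushLift hP c (tensorPush hP c x y) z ≫ k := by
  simpa only [Category.assoc] using congrArg (· ≫ k) (tensorPushLift_tensorAssoc_inv hP c x y z)

theorem tensorBraiding_hexagon_inv (x y z : P.Fiber A) :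
    (tensorAssoc hP c x y z).inv ≫ (tensorBraiding hP c (tensorPush hP c x y) z).hom ≫
      (tensorAssoc hP c z x y).inv =
      tensorMap hP c (𝟙 x) (tensorBraiding hP c y z).hom ≫ (tensorAssoc hP c x z y).inv ≫
        tensorMap hP c (tensorBraiding hP c x z).hom (𝟙 y) := by
  refine (isCocart_tensorPushLift_right hP c x y z).fiber_hom_ext ?_
  have h₁ : tensorPushLift hP c x z ▷ incl.obj y ≫
      incl.map (tensorBraiding hP c x z).hom ▷ incl.obj y =
      CartesianMonoidalCategory.lift (snd (incl.obj x) (incl.obj z)) (fst _ _) ▷ incl.obj y ≫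
        tensorPushLift hP c z x ▷ incl.obj y := by
    simp only [← MonoidalCategory.comp_whiskerRight, tensorPushLift_tensorBraiding]
  have h₂ : incl.obj x ◁ tensorPushLift hP c y z ≫
      incl.obj x ◁ incl.map (tensorBraiding hP c y z).hom =
      incl.obj x ◁ CartesianMonoidalCategory.lift (snd (incl.obj y) (incl.obj z)) (fst _ _) ≫
        incl.obj x ◁ tensorPushLift hP c z y := by
    simp only [← MonoidalCategory.whiskerLeft_comp, tensorPushLift_tensorBraiding]
  have h₃ : tensorPushLift hP c x y ▷ incl.obj z ≫ CartesianMonoidalCategory.lift (snd _ _)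
      (fst (incl.obj (tensorPush hP c x y)) (incl.obj z)) =
      CartesianMonoidalCategory.lift (snd _ _) (fst _ _) ≫
        incl.obj z ◁ tensorPushLift hP c x y := by
    ext <;> simp
  have h₄ : (α_ (incl.obj x) (incl.obj y) (incl.obj z)).inv ≫
      CartesianMonoidalCategory.lift (snd _ _) (fst _ _) ≫
        (α_ (incl.obj z) (incl.obj x) (incl.obj y)).inv =
      incl.obj x ◁ CartesianMonoidalCategory.lift (snd (incl.obj y) (incl.obj z)) (fst _ _) ≫
        (α_ (incl.obj x) (incl.obj z) (incl.obj y)).inv ≫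
        CartesianMonoidalCategory.lift (snd (incl.obj x) (incl.obj z)) (fst _ _) ▷
          incl.obj y := by
    ext <;> simp
  simp [reassoc_of% h₁, reassoc_of% h₂, reassoc_of% h₃, reassoc_of% h₄]

/-- The canonical monoidal structure of the fibre over `A`. -/
@[reducible]
noncomputable def fiberMonoidal (A : B) : MonoidalCategory (P.Fiber A) where
  tensorObj := tensorPush hP c
  tensorHom := tensorMap hP c
  whiskerLeft x _ _ φ := tensorMap hP c (𝟙 x) φ
  whiskerRight φ x := tensorMap hP c φ (𝟙 x)
  tensorUnit := unitPush hP c A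
  associator := tensorAssoc hP c
  leftUnitor := tensorLeftUnitor hP c
  rightUnitor := tensorRightUnitor hP c
  tensorHom_def φ ψ := by rw [tensorMap_comp, Category.comp_id, Category.id_comp]
  id_tensorHom_id := tensorMap_id hP c
  tensorHom_comp_tensorHom φ ψ φ' ψ' := tensorMap_comp hP c φ φ' ψ ψ'
  whiskerLeft_id := tensorMap_id hP c
  id_whiskerRight := tensorMap_id hP c
  associator_naturality := tensorAssoc_naturality hP c
  leftUnitor_naturality := tensorLeftUnitor_naturality hP c
  rightUnitor_naturality := tensorRightUnitor_naturality hP c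
  pentagon := tensorAssoc_pentagon hP c
  triangle := tensorUnitor_triangle hP c

/-- The canonical symmetric structure of the fibre over `A`. -/
@[reducible]
noncomputable def fiberSymmetric (A : B) :
    letI := fiberMonoidal hP c A
    SymmetricCategory (P.Fiber A) :=
  letI := fiberMonoidal hP c A
  { braiding := tensorBraiding hP c
    braiding_naturality_right x _ _ φ := tensorBraiding_naturality hP c (𝟙 x) φ
    braiding_naturality_left φ x := tensorBraiding_naturality hP c φ (𝟙 x)
    hexagon_forward := tensorBraiding_hexagon hP c
    hexagon_reverse := tensorBraiding_hexagon_inv hP c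
    symmetry := tensorBraiding_symmetry hP c }

end FiberCoherence

end TwoGroups
namespace TwoGroups

open Opcleavage

/-! ### Detecting isomorphisms by tensoring with invertible objects. -/

section Invertibility

variable {C : Type u₁} [Category.{v₁} C]

/-- A functor with a left inverse up to isomorphism reflects split monomorphisms: apply `H` to the
retraction and conjugate by `e`. No fullness of `G` is needed. -/
theorem exists_comp_eq_id_of_functor {D : Type u₂} [Category.{v₂} D] {G : C ⥤ D} {H : D ⥤ C}
    (e : G ⋙ H ≅ 𝟭 C) {x y : C} (φ : x ⟶ y) (r : G.obj y ⟶ G.obj x)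
    (h : G.map φ ≫ r = 𝟙 _) : ∃ s : y ⟶ x, φ ≫ s = 𝟙 x := by
  refine ⟨e.inv.app y ≫ H.map r ≫ e.hom.app x, ?_⟩
  have := e.inv.naturality_assoc φ (H.map r ≫ e.hom.app x)
  simp only [Functor.id_map, Functor.comp_map] at this
  rw [this, ← Functor.map_comp_assoc, h]
  simp

theorem exists_comp_eq_id_of_functor' {D : Type u₂} [Category.{v₂} D] {G : C ⥤ D} {H : D ⥤ C}
    (e : G ⋙ H ≅ 𝟭 C) {x y : C} (φ : x ⟶ y) (r : G.obj y ⟶ G.obj x)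
    (h : r ≫ G.map φ = 𝟙 _) : ∃ s : y ⟶ x, s ≫ φ = 𝟙 y := by
  refine ⟨e.inv.app y ≫ H.map r ≫ e.hom.app x, ?_⟩
  have := e.hom.naturality φ
  simp only [Functor.id_map, Functor.comp_map] at this
  rw [Category.assoc, Category.assoc, ← this, ← Functor.map_comp_assoc, h]
  simp

variable [MonoidalCategory C]

/-- Tensoring on the right with mutually inverse objects gives mutually inverse functors. -/
def tensorRightCompIso {a b : C} (e : a ⊗ b ≅ 𝟙_ C) : tensorRight a ⋙ tensorRight b ≅ 𝟭 C :=
  (tensorRightTensor a b).symm ≪≫ (tensoringRight C).mapIso e ≪≫ rightUnitorNatIso C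

/-- A morphism between invertible objects is invertible if its tensor product with some morphism
between inverse objects is. -/
theorem isIso_of_isIso_tensorHom {x y x' y' : C} (φ : x ⟶ y) (φ' : x' ⟶ y') [IsIso (φ ⊗ₘ φ')]
    (ex : x' ⊗ x ≅ 𝟙_ C) (ey : y' ⊗ y ≅ 𝟙_ C) : IsIso φ := by
  -- The two factorizations of `φ ⊗ φ'` through whiskerings are used in turn: one exhibits `φ ▷ x'`
  -- as a split monomorphism, the other `φ ▷ y'` as a split epimorphism. Both properties descend to
  -- `φ`, since `x` and `y` undo the tensoring.
  obtain ⟨r, hr⟩ := exists_comp_eq_id_of_functor (tensorRightCompIso ex) φ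
    (y ◁ φ' ≫ inv (φ ⊗ₘ φ')) (by
      change φ ▷ x' ≫ y ◁ φ' ≫ inv (φ ⊗ₘ φ') = 𝟙 _
      rw [← tensorHom_def_assoc, IsIso.hom_inv_id])
  obtain ⟨s, hs⟩ := exists_comp_eq_id_of_functor' (tensorRightCompIso ey) φ
    (inv (φ ⊗ₘ φ') ≫ x ◁ φ') (by
      change (inv (φ ⊗ₘ φ') ≫ x ◁ φ') ≫ φ ▷ y' = 𝟙 _
      rw [Category.assoc, ← tensorHom_def', IsIso.inv_hom_id])
  have hsr : s = r := by
    rw [← Category.comp_id s, ← hr, ← Category.assoc, hs, Category.id_comp]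
  exact ⟨r, hr, hsr ▸ hs⟩

end Invertibility

/-! ### Weak inverses, and the fibres as groupoids. -/

section FiberInverse

variable {X : Type u₁} [Category.{v₁} X] [CartesianMonoidalCategory X]
  {B : Type u₂} [Category.{v₂} B] [CartesianMonoidalCategory B] [Preadditive B]
  {P : X ⥤ B} (hP : IsCartesianMonoidalOpfibration P) (c : Opcleavage P) {A : B}
  (hτ : ∀ x : X, IsCocart P (toUnit x))
  (hΔ : ∀ x : X, IsCocart P (CartesianMonoidalCategory.lift (𝟙 x) (𝟙 x)))

/-- The morphism `x ⟶ x × (-1)_* x ⟶ x ⊗ (-1)_* x` over `0`. -/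
def tensorNegLift (x : P.Fiber A) :
    incl.obj x ⟶ incl.obj (tensorPush hP c x (c.push (-𝟙 A) x)) :=
  CartesianMonoidalCategory.lift (𝟙 (incl.obj x)) (𝟙 (incl.obj x)) ≫
    (incl.obj x ◁ c.lift (-𝟙 A) x) ≫ tensorPushLift hP c x (c.push (-𝟙 A) x)

theorem lift_whiskerLeft_neg_addHom (A : B) :
    CartesianMonoidalCategory.lift (𝟙 A) (𝟙 A) ≫ (A ◁ (-𝟙 A)) ≫ addHom A = 0 := by
  simp [addHom]

theorem isHomLift_tensorNegLift (x : P.Fiber A) :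
    P.IsHomLift (0 : A ⟶ A) (tensorNegLift hP c x) :=
  have h := IsHomLift.id (obj_incl x)
  have := hP.isHomLift_lift h h
  have := hP.isHomLift_whiskerLeft (f := -𝟙 A) (φ := c.lift (-𝟙 A) x) inferInstance (obj_incl x)
  isHomLift_congr (f := CartesianMonoidalCategory.lift (𝟙 A) (𝟙 A) ≫ (A ◁ (-𝟙 A)) ≫ addHom A)
    (by unfold tensorNegLift; infer_instance) (lift_whiskerLeft_neg_addHom A)

theorem isHomLift_toUnit_unitPushLift (x : P.Fiber A) :
    P.IsHomLift (0 : A ⟶ A) (toUnit (incl.obj x) ≫ unitPushLift hP c A) :=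
  have := hP.isHomLift_toUnit (obj_incl x)
  isHomLift_congr (f := toUnit A ≫ zeroHom A) inferInstance (by simp [zeroHom])

include hΔ in
-- This is where cocartesian diagonals enter: the remaining factors are a whiskered lifting of `-1`
-- and a lifting of the addition.
theorem isCocart_tensorNegLift (x : P.Fiber A) : IsCocart P (tensorNegLift hP c x) :=
  (hΔ _).comp ((hP.isCocart_whiskerLeft
    (isCocart_of_isStronglyCocartesian (c.isStronglyCocartesian (-𝟙 A) x)) _).comp
      (isCocart_tensorPushLift hP c _ _))

theorem tensorNegLift_tensorMap {x y : P.Fiber A} (φ : x ⟶ y) :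
    tensorNegLift hP c x ≫ incl.map (tensorMap hP c φ (c.pushMap (-𝟙 A) φ)) =
      incl.map φ ≫ tensorNegLift hP c y := by
  simp [tensorNegLift, comp_lift_assoc]

/-- The object `(-1)_* x` is a weak inverse of `x`. -/
noncomputable def tensorNegIso (x : P.Fiber A) :
    tensorPush hP c x (c.push (-𝟙 A) x) ≅ unitPush hP c A :=
  vertIso (0 : A ⟶ A) (tensorNegLift hP c x) (toUnit (incl.obj x) ≫ unitPushLift hP c A)
    ((isCocart_tensorNegLift hP c hΔ x).isStronglyCocartesian (isHomLift_tensorNegLift hP c x))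
    (((hτ _).comp (isCocart_unitPushLift hP c A)).isStronglyCocartesian
      (isHomLift_toUnit_unitPushLift hP c x))

theorem tensorNegLift_tensorNegIso (x : P.Fiber A) :
    tensorNegLift hP c x ≫ incl.map (tensorNegIso hP c hτ hΔ x).hom =
      toUnit (incl.obj x) ≫ unitPushLift hP c A :=
  comp_vertIso_hom _ _ _ _ _

/-- Tested on `x`, the left side becomes `x ⟶ y ⟶ I ⟶ E`, and uniqueness of maps to the terminal
object removes `φ`. Hence `φ ⊗ (-1)_* φ` is a composite of two isomorphisms, although `φ` is not yet
known to be one. -/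
theorem tensorMap_neg_tensorNegIso {x y : P.Fiber A} (φ : x ⟶ y) :
    tensorMap hP c φ (c.pushMap (-𝟙 A) φ) ≫ (tensorNegIso hP c hτ hΔ y).hom =
      (tensorNegIso hP c hτ hΔ x).hom := by
  refine (isCocart_tensorNegLift hP c hΔ x).fiber_hom_ext ?_
  rw [Functor.map_comp, ← Category.assoc, tensorNegLift_tensorMap, Category.assoc,
    tensorNegLift_tensorNegIso, tensorNegLift_tensorNegIso, ← Category.assoc, comp_toUnit]

include hτ hΔ in
theorem isIso_tensorMap_neg {x y : P.Fiber A} (φ : x ⟶ y) :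
    IsIso (tensorMap hP c φ (c.pushMap (-𝟙 A) φ)) := by
  have h := tensorMap_neg_tensorNegIso hP c hτ hΔ φ
  rw [← Iso.eq_comp_inv] at h
  rw [h]
  infer_instance

include hτ hΔ in
theorem isTwoGroup_fiber (A : B) :
    letI := fiberMonoidal hP c A
    IsTwoGroup (P.Fiber A) :=
  letI := fiberMonoidal hP c A
  letI := fiberSymmetric hP c A
  have e (x : P.Fiber A) : c.push (-𝟙 A) x ⊗ x ≅ 𝟙_ (P.Fiber A) :=
    β_ _ _ ≪≫ tensorNegIso hP c hτ hΔ x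
  { isIso {x y} φ :=
      have : IsIso (φ ⊗ₘ c.pushMap (-𝟙 A) φ) := isIso_tensorMap_neg hP c hτ hΔ φ
      isIso_of_isIso_tensorHom φ (c.pushMap (-𝟙 A) φ) (e x) (e y)
    exists_inverse x := ⟨c.push (-𝟙 A) x, ⟨tensorNegIso hP c hτ hΔ x⟩, ⟨e x⟩⟩ }

/-- The canonical structure of a symmetric 2-group on the fibre over `A`. -/
@[reducible]
noncomputable def fiberTwoGroup (A : B) : SymmetricTwoGroup (P.Fiber A) :=
  { toMonoidalCategory := fiberMonoidal hP c A
    toSymmetricCategory := fiberSymmetric hP c A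
    toIsTwoGroup := isTwoGroup_fiber hP c hτ hΔ A }

end FiberInverse

/-! ### Change of base as a symmetric monoidal functor, and its structure cells. -/

section ChangeOfBase

variable {X : Type u₁} [Category.{v₁} X] [CartesianMonoidalCategory X]
  {B : Type u₂} [Category.{v₂} B] [CartesianMonoidalCategory B] [Preadditive B]
  {P : X ⥤ B} (hP : IsCartesianMonoidalOpfibration P) (c : Opcleavage P) {A A' A'' : B}

theorem isCocart_lift_tensorPushLift (f : A ⟶ A') (x y : P.Fiber A) :
    IsCocart P ((c.lift f x ⊗ₘ c.lift f y) ≫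
      tensorPushLift hP c (c.push f x) (c.push f y)) :=
  (isCocart_lift_tensorHom_lift hP c f x y).comp (isCocart_tensorPushLift hP c _ _)

/-- The comparison `f_* x ⊗ f_* y ≅ f_* (x ⊗ y)`. -/
noncomputable def pushTensorIso (f : A ⟶ A') (x y : P.Fiber A) :
    tensorPush hP c (c.push f x) (c.push f y) ≅ c.push f (tensorPush hP c x y) :=
  vertIso (addHom A ≫ f)
    ((c.lift f x ⊗ₘ c.lift f y) ≫ tensorPushLift hP c (c.push f x) (c.push f y))
    (tensorPushLift hP c x y ≫ c.lift f (tensorPush hP c x y))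
    ((isCocart_lift_tensorPushLift hP c f x y).isStronglyCocartesian
      (have := hP.isHomLift_tensorHom (f := f) (g := f) (φ := c.lift f x) (ψ := c.lift f y)
        inferInstance inferInstance
      isHomLift_congr (f := (f ⊗ₘ f) ≫ addHom A') inferInstance (tensorHom_addHom f)))
    inferInstance

@[simp]
theorem lift_pushTensorIso (f : A ⟶ A') (x y : P.Fiber A) :
    (c.lift f x ⊗ₘ c.lift f y) ≫ tensorPushLift hP c (c.push f x) (c.push f y) ≫
        incl.map (pushTensorIso hP c f x y).hom =
      tensorPushLift hP c x y ≫ c.lift f (tensorPush hP c x y) := by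
  rw [← Category.assoc]
  exact comp_vertIso_hom _ _ _ _ _

@[simp]
theorem lift_pushTensorIso_assoc (f : A ⟶ A') (x y : P.Fiber A) {a : X}
    (k : incl.obj (c.push f (tensorPush hP c x y)) ⟶ a) :
    (c.lift f x ⊗ₘ c.lift f y) ≫ tensorPushLift hP c (c.push f x) (c.push f y) ≫
        incl.map (pushTensorIso hP c f x y).hom ≫ k =
      tensorPushLift hP c x y ≫ c.lift f (tensorPush hP c x y) ≫ k := by
  simpa only [Category.assoc] using congrArg (· ≫ k) (lift_pushTensorIso hP c f x y)

/-- The comparison `E ≅ f_* E`. -/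
noncomputable def pushUnitIso (f : A ⟶ A') : unitPush hP c A' ≅ c.push f (unitPush hP c A) :=
  vertIso (zeroHom A') (unitPushLift hP c A') (unitPushLift hP c A ≫ c.lift f (unitPush hP c A))
    inferInstance
    (((isCocart_unitPushLift hP c A).comp (isCocart_lift c f _)).isStronglyCocartesian
      (isHomLift_congr (f := zeroHom A ≫ f) inferInstance (zeroHom_comp f)))

@[simp]
theorem unitPushLift_pushUnitIso (f : A ⟶ A') :
    unitPushLift hP c A' ≫ incl.map (pushUnitIso hP c f).hom =
      unitPushLift hP c A ≫ c.lift f (unitPush hP c A) :=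
  comp_vertIso_hom _ _ _ _ _

@[simp]
theorem unitPushLift_pushUnitIso_assoc (f : A ⟶ A') {a : X}
    (k : incl.obj (c.push f (unitPush hP c A)) ⟶ a) :
    unitPushLift hP c A' ≫ incl.map (pushUnitIso hP c f).hom ≫ k =
      unitPushLift hP c A ≫ c.lift f (unitPush hP c A) ≫ k := by
  simpa only [Category.assoc] using congrArg (· ≫ k) (unitPushLift_pushUnitIso hP c f)

theorem pushTensorIso_naturality (f : A ⟶ A') {x y x' y' : P.Fiber A} (φ : x ⟶ x')
    (ψ : y ⟶ y') :
    tensorMap hP c (c.pushMap f φ) (c.pushMap f ψ) ≫ (pushTensorIso hP c f x' y').hom =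
      (pushTensorIso hP c f x y).hom ≫ c.pushMap f (tensorMap hP c φ ψ) := by
  refine (isCocart_lift_tensorPushLift hP c f x y).fiber_hom_ext ?_
  have h : (c.lift f x ⊗ₘ c.lift f y) ≫
      (incl.map (c.pushMap f φ) ⊗ₘ incl.map (c.pushMap f ψ)) =
      (incl.map φ ⊗ₘ incl.map ψ) ≫ (c.lift f x' ⊗ₘ c.lift f y') := by
    rw [tensorHom_comp_tensorHom, tensorHom_comp_tensorHom, lift_pushMap, lift_pushMap]
  simp [reassoc_of% h]

/-- Tested on `(x × y) × z` through the triple product of liftings of `f`, both sides reduce to the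
associator of `X` followed by the lifting to `x ⊗ (y ⊗ z)` and then the lifting of `f`. -/
theorem pushTensorIso_associativity (f : A ⟶ A') (x y z : P.Fiber A) :
    tensorMap hP c (pushTensorIso hP c f x y).hom (𝟙 (c.push f z)) ≫
      (pushTensorIso hP c f (tensorPush hP c x y) z).hom ≫
        c.pushMap f (tensorAssoc hP c x y z).hom =
      (tensorAssoc hP c (c.push f x) (c.push f y) (c.push f z)).hom ≫
        tensorMap hP c (𝟙 (c.push f x)) (pushTensorIso hP c f y z).hom ≫
          (pushTensorIso hP c f x (tensorPush hP c y z)).hom := by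
  refine ((hP.tensor_isCocart _ _ (isCocart_lift_tensorHom_lift hP c f x y)
    (isCocart_lift c f z)).comp (isCocart_tensorPushLift_left hP c (c.push f x) (c.push f y)
      (c.push f z))).fiber_hom_ext ?_
  have h₁ : ((c.lift f x ⊗ₘ c.lift f y) ⊗ₘ c.lift f z) ≫
      tensorPushLift hP c (c.push f x) (c.push f y) ▷ incl.obj (c.push f z) ≫
        incl.map (pushTensorIso hP c f x y).hom ▷ incl.obj (c.push f z) =
      tensorPushLift hP c x y ▷ incl.obj z ≫ (c.lift f (tensorPush hP c x y) ⊗ₘ c.lift f z) := by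
    simp only [← tensorHom_id, tensorHom_comp_tensorHom, lift_pushTensorIso, Category.comp_id,
      Category.id_comp]
  have h₂ : (c.lift f x ⊗ₘ (c.lift f y ⊗ₘ c.lift f z)) ≫
      incl.obj (c.push f x) ◁ tensorPushLift hP c (c.push f y) (c.push f z) ≫
        incl.obj (c.push f x) ◁ incl.map (pushTensorIso hP c f y z).hom =
      incl.obj x ◁ tensorPushLift hP c y z ≫ (c.lift f x ⊗ₘ c.lift f (tensorPush hP c y z)) := by
    simp only [← id_tensorHom, tensorHom_comp_tensorHom, lift_pushTensorIso, Category.comp_id,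
      Category.id_comp]
  -- `associator_conjugation` is disabled because it would rebracket the triple product of liftings
  -- that `h₁` has to match; the unitality proofs disable `id_whiskerLeft` and `whiskerRight_id` for
  -- the analogous reason.
  simp [reassoc_of% h₁, reassoc_of% h₂, MonoidalCategory.associator_naturality_assoc,
    -MonoidalCategory.associator_conjugation]

theorem pushTensorIso_left_unitality (f : A ⟶ A') (x : P.Fiber A) :
    (tensorLeftUnitor hP c (c.push f x)).hom =
      tensorMap hP c (pushUnitIso hP c f).hom (𝟙 (c.push f x)) ≫
        (pushTensorIso hP c f (unitPush hP c A) x).hom ≫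
          c.pushMap f (tensorLeftUnitor hP c x).hom := by
  refine ((hP.isCocart_whiskerLeft (isCocart_lift c f x) (𝟙_ X)).comp
    (isCocart_unitPushLift_left hP c (c.push f x))).fiber_hom_ext ?_
  have h : 𝟙_ X ◁ c.lift f x ≫ unitPushLift hP c A' ▷ incl.obj (c.push f x) ≫
      incl.map (pushUnitIso hP c f).hom ▷ incl.obj (c.push f x) =
      unitPushLift hP c A ▷ incl.obj x ≫ (c.lift f (unitPush hP c A) ⊗ₘ c.lift f x) := by
    simp only [← id_tensorHom, ← tensorHom_id, tensorHom_comp_tensorHom,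
      unitPushLift_pushUnitIso, Category.comp_id, Category.id_comp]
  simp [reassoc_of% h, -MonoidalCategory.id_whiskerLeft]

theorem pushTensorIso_right_unitality (f : A ⟶ A') (x : P.Fiber A) :
    (tensorRightUnitor hP c (c.push f x)).hom =
      tensorMap hP c (𝟙 (c.push f x)) (pushUnitIso hP c f).hom ≫
        (pushTensorIso hP c f x (unitPush hP c A)).hom ≫
          c.pushMap f (tensorRightUnitor hP c x).hom := by
  refine ((hP.isCocart_whiskerRight (isCocart_lift c f x) (𝟙_ X)).comp
    (isCocart_unitPushLift_right hP c (c.push f x))).fiber_hom_ext ?_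
  have h : c.lift f x ▷ 𝟙_ X ≫ incl.obj (c.push f x) ◁ unitPushLift hP c A' ≫
      incl.obj (c.push f x) ◁ incl.map (pushUnitIso hP c f).hom =
      incl.obj x ◁ unitPushLift hP c A ≫ (c.lift f x ⊗ₘ c.lift f (unitPush hP c A)) := by
    simp only [← id_tensorHom, ← tensorHom_id, tensorHom_comp_tensorHom,
      unitPushLift_pushUnitIso, Category.comp_id, Category.id_comp]
  simp [reassoc_of% h, -MonoidalCategory.whiskerRight_id]

theorem pushTensorIso_braiding (f : A ⟶ A') (x y : P.Fiber A) :
    (pushTensorIso hP c f x y).hom ≫ c.pushMap f (tensorBraiding hP c x y).hom =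
      (tensorBraiding hP c (c.push f x) (c.push f y)).hom ≫ (pushTensorIso hP c f y x).hom := by
  refine (isCocart_lift_tensorPushLift hP c f x y).fiber_hom_ext ?_
  have h : (c.lift f x ⊗ₘ c.lift f y) ≫ CartesianMonoidalCategory.lift
      (snd (incl.obj (c.push f x)) (incl.obj (c.push f y))) (fst _ _) =
      CartesianMonoidalCategory.lift (snd (incl.obj x) (incl.obj y)) (fst _ _) ≫
        (c.lift f y ⊗ₘ c.lift f x) := by
    ext <;> simp
  simp [reassoc_of% h]

/-- The canonical symmetric monoidal structure of the change of base functor. -/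
@[reducible]
noncomputable def pushFunctorBraided (f : A ⟶ A') :
    letI := fiberMonoidal hP c A
    letI := fiberMonoidal hP c A'
    letI := fiberSymmetric hP c A
    letI := fiberSymmetric hP c A'
    (c.pushFunctor f).Braided :=
  letI := fiberMonoidal hP c A
  letI := fiberMonoidal hP c A'
  letI := fiberSymmetric hP c A
  letI := fiberSymmetric hP c A'
  letI M : (c.pushFunctor f).CoreMonoidal :=
    { εIso := pushUnitIso hP c f
      μIso := pushTensorIso hP c f
      μIso_hom_natural_left φ x := by
        have := pushTensorIso_naturality hP c f φ (𝟙 x)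
        rwa [show c.pushMap f (𝟙 x) = 𝟙 _ from (c.pushFunctor f).map_id x] at this
      μIso_hom_natural_right x φ := by
        have := pushTensorIso_naturality hP c f (𝟙 x) φ
        rwa [show c.pushMap f (𝟙 x) = 𝟙 _ from (c.pushFunctor f).map_id x] at this
      associativity := pushTensorIso_associativity hP c f
      left_unitality := pushTensorIso_left_unitality hP c f
      right_unitality := pushTensorIso_right_unitality hP c f }
  { toMonoidal := M.toMonoidal
    braided := pushTensorIso_braiding hP c f }

theorem pushUnitIso_pushIdIso (A : B) :
    (pushUnitIso hP c (𝟙 A)).hom ≫ (c.pushIdIso (unitPush hP c A)).hom = 𝟙 _ :=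
  (isCocart_unitPushLift hP c A).fiber_hom_ext (by simp)

theorem pushTensorIso_pushIdIso (x y : P.Fiber A) :
    (pushTensorIso hP c (𝟙 A) x y).hom ≫ (c.pushIdIso (tensorPush hP c x y)).hom =
      tensorMap hP c (c.pushIdIso x).hom (c.pushIdIso y).hom :=
  (isCocart_lift_tensorPushLift hP c (𝟙 A) x y).fiber_hom_ext
    (by simp [tensorHom_comp_tensorHom_assoc])

theorem pushUnitIso_pushCompIso (f : A ⟶ A') (g : A' ⟶ A'') :
    (pushUnitIso hP c (f ≫ g)).hom ≫ (c.pushCompIso f g (unitPush hP c A)).hom =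
      (pushUnitIso hP c g).hom ≫ c.pushMap g (pushUnitIso hP c f).hom :=
  (isCocart_unitPushLift hP c A'').fiber_hom_ext (by simp)

/-- Precomposed with the product of the liftings of `f ≫ g`, both sides become the chain of chosen
liftings `x × y ⟶ x ⊗ y ⟶ f_* (x ⊗ y) ⟶ g_* f_* (x ⊗ y)`. -/
theorem pushTensorIso_pushCompIso (f : A ⟶ A') (g : A' ⟶ A'') (x y : P.Fiber A) :
    (pushTensorIso hP c (f ≫ g) x y).hom ≫ (c.pushCompIso f g (tensorPush hP c x y)).hom =
      tensorMap hP c (c.pushCompIso f g x).hom (c.pushCompIso f g y).hom ≫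
        (pushTensorIso hP c g (c.push f x) (c.push f y)).hom ≫
          c.pushMap g (pushTensorIso hP c f x y).hom := by
  refine (isCocart_lift_tensorPushLift hP c (f ≫ g) x y).fiber_hom_ext ?_
  have h : (c.lift (f ≫ g) x ⊗ₘ c.lift (f ≫ g) y) ≫
      (incl.map (c.pushCompIso f g x).hom ⊗ₘ incl.map (c.pushCompIso f g y).hom) =
      (c.lift f x ⊗ₘ c.lift f y) ≫
        (c.lift g (c.push f x) ⊗ₘ c.lift g (c.push f y)) := by
    simp only [tensorHom_comp_tensorHom, lift_pushCompIso]
  simp [reassoc_of% h]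

end ChangeOfBase

end TwoGroups
namespace TwoGroups

/-! ### Assembling the canonical factorization. -/

section CanonicalLift

variable {X : Type u₁} [Category.{v₁} X] [CartesianMonoidalCategory X]
  {B : Type u₂} [Category.{v₂} B] [CartesianMonoidalCategory B] [Preadditive B]
  {P : X ⥤ B} (hP : IsCartesianMonoidalOpfibration P) (c : Opcleavage P)
  (hτ : ∀ x : X, IsCocart P (toUnit x))
  (hΔ : ∀ x : X, IsCocart P (CartesianMonoidalCategory.lift (𝟙 x) (𝟙 x)))

theorem isMonoidal_pushId (A : B) :
    letI := fiberTwoGroup hP c hτ hΔ A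
    letI := pushFunctorBraided hP c (𝟙 A)
    NatTrans.IsMonoidal (c.pushId A).hom :=
  letI := fiberTwoGroup hP c hτ hΔ A
  letI := pushFunctorBraided hP c (𝟙 A)
  { unit := pushUnitIso_pushIdIso hP c A
    -- The extra identity is the tensorator of the identity functor.
    tensor x y := (pushTensorIso_pushIdIso hP c x y).trans (Category.comp_id _).symm }

theorem isMonoidal_pushComp {A A' A'' : B} (f : A ⟶ A') (g : A' ⟶ A'') :
    letI := fiberTwoGroup hP c hτ hΔ A
    letI := fiberTwoGroup hP c hτ hΔ A'
    letI := fiberTwoGroup hP c hτ hΔ A''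
    letI := pushFunctorBraided hP c f
    letI := pushFunctorBraided hP c g
    letI := pushFunctorBraided hP c (f ≫ g)
    NatTrans.IsMonoidal (c.pushComp f g).hom :=
  letI := fiberTwoGroup hP c hτ hΔ A
  letI := fiberTwoGroup hP c hτ hΔ A'
  letI := fiberTwoGroup hP c hτ hΔ A''
  letI := pushFunctorBraided hP c f
  letI := pushFunctorBraided hP c g
  letI := pushFunctorBraided hP c (f ≫ g)
  { unit := pushUnitIso_pushCompIso hP c f g
    tensor := pushTensorIso_pushCompIso hP c f g }

/-- The canonical factorization through symmetric 2-groups of the pseudofunctor associated with a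
cartesian monoidal opfibration. -/
noncomputable def canonicalLift : SCGLift c.pseudofunctor where
  obj A := fiberTwoGroup hP c hτ hΔ A.as
  map f := pushFunctorBraided hP c f.as
  map₂_isMonoidal {a b f g} η := by
    -- The domain is locally discrete, so every 2-cell is an identity.
    obtain rfl := LocallyDiscrete.eq_of_hom η
    obtain rfl : η = 𝟙 f := Subsingleton.elim _ _
    rw [PrelaxFunctor.map₂_id]
    let := fiberTwoGroup hP c hτ hΔ a.as
    let := fiberTwoGroup hP c hτ hΔ b.as
    let := pushFunctorBraided hP c f.as
    exact NatTrans.IsMonoidal.id (F₁ := c.pushFunctor f.as)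
  mapId_isMonoidal a := isMonoidal_pushId hP c hτ hΔ a.as
  mapComp_isMonoidal f g := isMonoidal_pushComp hP c hτ hΔ f.as g.as

theorem hasCanonicalObj_fiberTwoGroup (A : B) :
    letI := fiberTwoGroup hP c hτ hΔ A
    HasCanonicalObj hP c A :=
  letI := fiberTwoGroup hP c hτ hΔ A
  { tensor_eq _ _ := rfl
    unit_eq := rfl }

/-- For this structure the tensor product is `tensorPush` by definition, so the transport built into
`tensorLift` is along a reflexive equality and disappears. -/
theorem tensorLift_fiberTwoGroup {A : B} (x y : P.Fiber A) :
    letI := fiberTwoGroup hP c hτ hΔ A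
    (hasCanonicalObj_fiberTwoGroup hP c hτ hΔ A).tensorLift x y = tensorPushLift hP c x y :=
  (congrArg (tensorPushLift hP c x y ≫ ·) (CategoryTheory.Functor.map_id _ _)).trans (Category.comp_id _)

theorem unitLift_fiberTwoGroup (A : B) :
    letI := fiberTwoGroup hP c hτ hΔ A
    (hasCanonicalObj_fiberTwoGroup hP c hτ hΔ A).unitLift = unitPushLift hP c A :=
  (congrArg (unitPushLift hP c A ≫ ·) (CategoryTheory.Functor.map_id _ _)).trans (Category.comp_id _)

theorem isCanonical_fiberTwoGroup (A : B) :
    letI := fiberTwoGroup hP c hτ hΔ A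
    (hasCanonicalObj_fiberTwoGroup hP c hτ hΔ A).IsCanonical :=
  letI := fiberTwoGroup hP c hτ hΔ A
  { tensorHom φ ψ := by
      simp only [tensorLift_fiberTwoGroup]
      exact tensorPushLift_tensorMap hP c φ ψ
    associator x y z := by
      simp only [tensorLift_fiberTwoGroup]
      exact tensorPushLift_tensorAssoc hP c x y z
    leftUnitor x := by
      simp only [tensorLift_fiberTwoGroup, unitLift_fiberTwoGroup]
      exact tensorPushLift_tensorLeftUnitor hP c x
    rightUnitor x := by
      simp only [tensorLift_fiberTwoGroup, unitLift_fiberTwoGroup]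
      exact tensorPushLift_tensorRightUnitor hP c x
    braiding x y := by
      simp only [tensorLift_fiberTwoGroup]
      exact tensorPushLift_tensorBraiding hP c x y
    inverse x := ⟨tensorNegIso hP c hτ hΔ x⟩ }

theorem isCanonicalMap_pushFunctorBraided {A A' : B} (f : A ⟶ A') :
    letI := fiberTwoGroup hP c hτ hΔ A
    letI := fiberTwoGroup hP c hτ hΔ A'
    (hasCanonicalObj_fiberTwoGroup hP c hτ hΔ A).IsCanonicalMap
      (hasCanonicalObj_fiberTwoGroup hP c hτ hΔ A') f (pushFunctorBraided hP c f) :=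
  letI := fiberTwoGroup hP c hτ hΔ A
  letI := fiberTwoGroup hP c hτ hΔ A'
  letI := pushFunctorBraided hP c f
  { unit := by
      simp only [unitLift_fiberTwoGroup]
      exact unitPushLift_pushUnitIso hP c f
    tensor x y := by
      simp only [tensorLift_fiberTwoGroup]
      exact lift_pushTensorIso hP c f x y }

theorem isCanonicalLift_canonicalLift : IsCanonicalLift hP c (canonicalLift hP c hτ hΔ) where
  obj := hasCanonicalObj_fiberTwoGroup hP c hτ hΔ
  isCanonical := isCanonical_fiberTwoGroup hP c hτ hΔ
  isCanonicalMap := isCanonicalMap_pushFunctorBraided hP c hτ hΔ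

end CanonicalLift

end TwoGroups

theorem theorem5p7 {X : Type u₁} [Category.{v₁} X] [CartesianMonoidalCategory X]
    {B : Type u₂} [Category.{v₂} B] [Preadditive B] [CartesianMonoidalCategory B]
    (P : X ⥤ B) (hP : TwoGroups.IsCartesianMonoidalOpfibration P) (c : TwoGroups.Opcleavage P)
    (hτ : ∀ x : X, TwoGroups.IsCocart P (toUnit x))
    (hΔ : ∀ x : X, TwoGroups.IsCocart P (lift (𝟙 x) (𝟙 x))) :
    ∃ L : TwoGroups.SCGLift c.pseudofunctor,
      L.toPseudofunctor.comp TwoGroups.SCG.forget = c.pseudofunctor ∧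
        TwoGroups.IsCanonicalLift hP c L :=
  let L := TwoGroups.canonicalLift hP c hτ hΔ
  ⟨L, L.toPseudofunctor_comp_forget, TwoGroups.isCanonicalLift_canonicalLift hP c hτ hΔ⟩
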